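/- Let $\Omega$ be $\mathbb R^d$ or the torus $\mathbb T^d=\mathbb R^d/\mathbb Z^d$, and let $T,\delta,\lambda>0$. Let $m_0$ be a Borel probability measure on $\Omega$, let $\Psi:\Omega\to\mathbb R$ be Lipschitz continuous, and let $\eta$ be a bounded, strictly positive, Lipschitz continuous function on $\mathbb R^d$ (on $\mathbb T^d$, if $\Omega=\mathbb T^d$) such that, for some constant $C$, $|\nabla\eta(y)|\le C\,\eta(y)$ at every point $y$ where $\eta$ is differentiable. Let $\Gamma=C([0,T];\Omega)$ with the topology of uniform convergence. For $\gamma,\omega\in\Gamma$ set $$K(\gamma)=\tfrac12\int_0^T|\gamma'(t)|^2\,dt,\qquad V(\gamma,\omega)=\tfrac12\int_0^T|\gamma'(t)-\omega'(t)|^2\,\eta(\gamma(t)-\omega(t))\,dt,$$ where $K(\gamma)=+\infty$ if $\gamma\notin H^1$ and $V(\gamma,\omega)=+\infty$ if $\gamma-\omega\notin H^1$. For a Borel probability measure $Q$ on $\Gamma$ set $$F(\gamma,Q)=\delta K(\gamma)+\Psi(\gamma(T))+\lambda\int_\Gamma V(\gamma,\omega)\,dQ(\omega)\in(-\infty,+\infty].$$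 Call $Q$ an equilibrium if the image of $Q$ under $\gamma\mapsto\gamma(0)$ is $m_0$, if $\int_\Gamma F(\gamma,Q)\,dQ(\gamma)<+\infty$ (that is, the positive part of $F(\cdot,Q)$ is $Q$-integrable), and if $$F(\gamma,Q)=\inf\{F(\omega,Q):\ \omega\in\Gamma,\ \omega(0)=\gamma(0)\}\qquad\text{for every }\gamma\in\operatorname{spt}(Q).$$ Let $Q$ be an equilibrium. If $\Omega=\mathbb R^d$, assume moreover that the negative part of $\Psi$ is $m_0$-integrable, or that $\int_\Gamma K\,dQ<+\infty$. Then there is a constant $L$, depending only on $Q$ and on the data $(\Omega,T,\delta,\lambda,\Psi,\eta,m_0)$, such that every $\gamma\in\operatorname{spt}(Q)$ is of class $C^{1,1}$ on $[0,T]$ and $\gamma'$ is $L$-Lipschitz on $[0,T]$. -/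

import Mathlib

open MeasureTheory Set
open scoped ENNReal NNReal

/-- The Euclidean space `ℝ^d`. -/
abbrev Eucl (d : ℕ) : Type := EuclideanSpace ℝ (Fin d)

/-- The projection of `ℝ^d` onto the torus `ℝ^d / ℤ^d`. -/
def torusProj (d : ℕ) (x : Eucl d) : UnitAddTorus (Fin d) := fun i => ((x i : ℝ) : UnitAddCircle)

/-- The space of continuous curves `[0,T] → Ω`, with the topology of uniform convergence
(the compact-open topology, since `[0,T]` is compact). -/
abbrev Curve (Ω : Type) [TopologicalSpace Ω] (T : ℝ) : Type := C(Icc (0 : ℝ) T, Ω)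

/-- Measures on curves are Borel measures. -/
instance curveMeasurableSpace (Ω : Type) [TopologicalSpace Ω] (T : ℝ) :
    MeasurableSpace (Curve Ω T) := borel _

instance curveBorelSpace (Ω : Type) [TopologicalSpace Ω] (T : ℝ) :
    BorelSpace (Curve Ω T) := ⟨rfl⟩

/-! In what follows `π : ℝ^d → Ω` is the canonical projection: the identity when `Ω = ℝ^d`,
and `torusProj d` when `Ω` is the torus. Derivatives of curves in `Ω` are those of their lifts
to `ℝ^d`, and derivatives of functions on `Ω` are those of their pull-backs to `ℝ^d`. -/

section Curves

variable {d : ℕ} {Ω : Type} [NormedAddCommGroup Ω]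

/-- `γ` is a curve of class `H¹` with derivative `v ∈ L²(0,T)`: it is the projection of
`t ↦ x₀ + ∫₀ᵗ v`, for some `x₀`. The derivative `v` is determined by `γ` up to a null set. -/
def HasL2Velocity (π : Eucl d → Ω) {T : ℝ} (γ : Curve Ω T) (v : ℝ → Eucl d) : Prop :=
  MemLp v 2 (volume.restrict (Icc 0 T)) ∧
    ∃ x₀ : Eucl d, ∀ t : Icc (0 : ℝ) T, γ t = π (x₀ + ∫ s in (0 : ℝ)..t, v s)

/-- `γ ∈ H¹([0,T]; Ω)`. -/
def IsH1 (π : Eucl d → Ω) {T : ℝ} (γ : Curve Ω T) : Prop :=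
  ∃ v : ℝ → Eucl d, HasL2Velocity π γ v

open Classical in
/-- The derivative `γ'` of a curve of class `H¹` (a representative of its class in `L²`). -/
noncomputable def velocity (π : Eucl d → Ω) {T : ℝ} (γ : Curve Ω T) : ℝ → Eucl d :=
  if h : IsH1 π γ then h.choose else 0

open Classical in
/-- `½ ∫₀ᵀ |γ'(t)|² w(γ(t)) dt` if `γ ∈ H¹`, and `+∞` otherwise (for a weight `w ≥ 0`). -/
noncomputable def weightedEnergy (π : Eucl d → Ω) (w : Ω → ℝ) {T : ℝ} (γ : Curve Ω T) : ℝ≥0∞ :=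
  if IsH1 π γ then
    ∫⁻ t : Icc (0 : ℝ) T, ENNReal.ofReal (1 / 2 * ‖velocity π γ t‖ ^ 2 * w (γ t))
      ∂(volume.comap Subtype.val)
  else ⊤

/-- The kinetic energy `K(γ)`. -/
noncomputable def kineticEnergy (π : Eucl d → Ω) {T : ℝ} (γ : Curve Ω T) : ℝ≥0∞ :=
  weightedEnergy π (fun _ => 1) γ

/-- The interaction cost `V(γ,ω) = ½ ∫₀ᵀ |γ' - ω'|² η(γ - ω) dt` if `γ - ω ∈ H¹`,
and `+∞` otherwise. -/
noncomputable def interaction (π : Eucl d → Ω) (η : Ω → ℝ) {T : ℝ} (γ ω : Curve Ω T) : ℝ≥0∞ :=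
  weightedEnergy π η (γ - ω)

/-- `γ` is of class `C^{1,1}` on `[0,T]`, and `γ'` is `L`-Lipschitz: `γ` has a lift `c` to `ℝ^d`
that is differentiable at every point of `[0,T]` (one-sidedly at the end points) with derivative
`L`-Lipschitz on `[0,T]`. -/
def IsC11With (π : Eucl d → Ω) {T : ℝ} (L : ℝ≥0) (γ : Curve Ω T) : Prop :=
  ∃ c v : ℝ → Eucl d, (∀ t : Icc (0 : ℝ) T, γ t = π (c t)) ∧
    (∀ t ∈ Icc (0 : ℝ) T, HasDerivWithinAt c (v t) (Icc 0 T) t) ∧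
    LipschitzOnWith L v (Icc 0 T)

end Curves

/-- The data of the game with velocity interactions on `Ω`, with the standing assumptions. -/
structure MFG (Ω : Type) [NormedAddCommGroup Ω] [MeasurableSpace Ω] where
  /-- time horizon -/
  T : ℝ
  T_pos : 0 < T
  /-- weight of the kinetic energy -/
  δ : ℝ
  δ_pos : 0 < δ
  /-- weight of the interaction (the parameter `λ`) -/
  lam : ℝ
  lam_pos : 0 < lam
  /-- final cost -/
  Ψ : Ω → ℝ
  Ψ_continuous : Continuous Ψ
  Ψ_bounded_or_lipschitz : (∃ C, ∀ x, |Ψ x| ≤ C) ∨ ∃ K, LipschitzWith K Ψ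
  /-- interaction kernel, a function of the difference of two positions -/
  η : Ω → ℝ
  η_continuous : Continuous η
  η_nonneg : ∀ y, 0 ≤ η y
  η_bounded : ∃ C, ∀ y, η y ≤ C
  /-- initial distribution of the players -/
  m₀ : Measure Ω
  m₀_prob : IsProbabilityMeasure m₀

namespace MFG

variable {d : ℕ} {Ω : Type} [NormedAddCommGroup Ω] [MeasurableSpace Ω]

/-- `η` is strictly positive and Lipschitz, and `|∇η| ≤ C η` for some `C`, at every point where
the (almost everywhere differentiable) function `η` is differentiable. -/
def KernelCondition (π : Eucl d → Ω) (G : MFG Ω) : Prop :=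
  (∀ y, 0 < G.η y) ∧ (∃ K, LipschitzWith K G.η) ∧
    ∃ C : ℝ, ∀ y : Eucl d, DifferentiableAt ℝ (fun x => G.η (π x)) y →
      ‖fderiv ℝ (fun x => G.η (π x)) y‖ ≤ C * G.η (π y)

/-- `Ψ` is Lipschitz. -/
def FinalCostCondition (G : MFG Ω) : Prop := ∃ K, LipschitzWith K G.Ψ

/-- `V_Q(γ) = ∫ V(γ,ω) dQ(ω)`. -/
noncomputable def VQ (π : Eucl d → Ω) (G : MFG Ω) (Q : Measure (Curve Ω G.T))
    (γ : Curve Ω G.T) : ℝ≥0∞ :=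
  ∫⁻ ω, interaction π G.η γ ω ∂Q

/-- `F(γ,Q) = δ K(γ) + Ψ(γ(T)) + λ V_Q(γ)`, with values in `(-∞,+∞]`. -/
noncomputable def F (π : Eucl d → Ω) (G : MFG Ω) (Q : Measure (Curve Ω G.T))
    (γ : Curve Ω G.T) : EReal :=
  ((ENNReal.ofReal G.δ * kineticEnergy π γ : ℝ≥0∞) : EReal)
    + ((G.Ψ (γ ⟨G.T, right_mem_Icc.2 G.T_pos.le⟩) : ℝ) : EReal)
    + ((ENNReal.ofReal G.lam * G.VQ π Q γ : ℝ≥0∞) : EReal)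

/-- The initial point `γ(0)`. -/
def start (G : MFG Ω) (γ : Curve Ω G.T) : Ω := γ ⟨0, left_mem_Icc.2 G.T_pos.le⟩

/-- The probability measure `Q` on curves is an equilibrium: its initial distribution is `m₀`,
`∫ F(γ,Q) dQ(γ) < +∞` (i.e. the positive part of `F(·,Q)` has a finite integral), and every
curve of the support of `Q` minimizes `F(·,Q)` among the curves with the same initial point. -/
structure IsEquilibrium (π : Eucl d → Ω) (G : MFG Ω) (Q : Measure (Curve Ω G.T)) : Prop where
  isProb : IsProbabilityMeasure Q
  initial : Q.map G.start = G.m₀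
  finite_cost : ∫⁻ γ, (G.F π Q γ).toENNReal ∂Q < ⊤
  optimal : ∀ γ ∈ Q.support, G.F π Q γ = ⨅ ω ∈ {ω : Curve Ω G.T | G.start ω = G.start γ}, G.F π Q ω

end MFG

/-! Every curve `γ` in the support minimizes `F(·,Q)` with its starting point fixed. Comparison with
the constant curve bounds `K(γ)` and `V_Q(γ)` by one constant, because `Ψ` is Lipschitz and the mean
kinetic energy of `Q` is finite.

The gradient condition makes `log η` Lipschitz, so the displacement `γ + εφ` multiplies the weight
`η(γ - ω)` by at most `exp(Cε|φ|)`. The resulting first variation needs no derivative of `η` or `Ψ`.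
It is an inequality, and says weakly that the momentum `p = δγ' + λ∫(γ' - ω')η(γ - ω) dQ(ω)`
satisfies `|p'| ≤ λCe` and `|p(T)| ≤ Lip Ψ`, where `e` is the time density of `V_Q(γ)`. Since `∫e`
is bounded uniformly, so is `p` (`WeakEulerLagrange.ae_norm_le`).

To pass from `p` to `γ'`, read the definition of `p` at a fixed time as `(δ + λ∫k)γ' = p + λ∫kω'
dQ(ω)`, with `k = η(γ - ω)`. A velocity is thus an average of the other velocities plus a source,
and the coefficient `δ > 0` gives a maximum principle over the players: `|γ'| ≤ sup|p|/δ`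
(`ae_le_of_ae_le_weighted_average`).

Bounded velocities make `e` bounded, hence `p` Lipschitz (`WeakEulerLagrange.ae_norm_sub_le`). The
increments `γ'(s) - γ'(t)` obey the same averaged relation, with weights frozen at `t` and an error
`O(|s - t|)` because `η` is Lipschitz and the curves are uniformly Lipschitz. A second use of the
maximum principle makes `γ'` Lipschitz, uniformly on the support. -/

/-! ### Log-Lipschitz bound for the kernel -/

section Kernel

open Filter Topology

/-- Grönwall's inequality for Lipschitz functions, with an almost everywhere hypothesis. -/
theorem le_mul_exp_of_ae_abs_deriv_le {h : ℝ → ℝ} {K : ℝ≥0} (hK : LipschitzWith K h) {c : ℝ}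
    (hd : ∀ᵐ τ : ℝ, |deriv h τ| ≤ c * h τ) : h 1 ≤ h 0 * Real.exp c := by
  have hg : ∀ τ : ℝ, HasDerivAt (fun τ => Real.exp (-(c * τ))) (Real.exp (-(c * τ)) * (-c)) τ := by
    intro τ
    have h1 : HasDerivAt (fun τ => -(c * τ)) (-c) τ := by
      simpa using ((hasDerivAt_id τ).const_mul c).fun_neg
    exact h1.exp
  have hgac : AbsolutelyContinuousOnInterval (fun τ : ℝ => Real.exp (-(c * τ))) 0 1 := by
    apply ContDiffOn.absolutelyContinuousOnInterval
    apply ContDiff.contDiffOn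
    fun_prop
  have hhac : AbsolutelyContinuousOnInterval h 0 1 :=
    (hK.lipschitzOnWith (s := uIcc 0 1)).absolutelyContinuousOnInterval
  -- The product `h(τ) exp(-cτ)` is absolutely continuous with nonpositive derivative almost
  -- everywhere.
  have key := hhac.integral_deriv_mul_eq_sub hgac
  have hnn : 0 ≤ ∫ x in (0 : ℝ)..1, -(deriv h x * Real.exp (-(c * x)) +
      h x * deriv (fun τ : ℝ => Real.exp (-(c * τ))) x) := by
    apply intervalIntegral.integral_nonneg_of_ae zero_le_one
    filter_upwards [hd] with x hx
    rw [(hg x).deriv]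
    have h1 := (abs_le.1 hx).2
    have h2 := Real.exp_pos (-(c * x))
    simp only [Pi.zero_apply]
    nlinarith
  rw [intervalIntegral.integral_neg, key] at hnn
  simp only [mul_one, mul_zero, neg_zero, Real.exp_zero] at hnn
  have h3 : h 1 * Real.exp (-c) ≤ h 0 := by linarith
  calc h 1 = (h 1 * Real.exp (-c)) * Real.exp c := by
        rw [mul_assoc, ← Real.exp_add]; simp
    _ ≤ _ := mul_le_mul_of_nonneg_right h3 (Real.exp_pos _).le

/-- A given segment may consist of points of non-differentiability. By Rademacher and Fubini, for
almost every `x` the segment from `x` to `x + z` meets that set in a null set of parameters, and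
Grönwall applies along it. Continuity of `g` then reaches every `x`. -/
theorem LipschitzWith.le_mul_exp_of_norm_fderiv_le {E : Type*} [NormedAddCommGroup E]
    [NormedSpace ℝ E] [FiniteDimensional ℝ E] [MeasurableSpace E] [BorelSpace E]
    {g : E → ℝ} {K : ℝ≥0} (hK : LipschitzWith K g) {C : ℝ}
    (hd : ∀ y, DifferentiableAt ℝ g y → ‖fderiv ℝ g y‖ ≤ C * g y) (x z : E) :
    g (x + z) ≤ g x * Real.exp (C * ‖z‖) := by
  let μ : Measure E := Measure.addHaar
  have hD : MeasurableSet {x | DifferentiableAt ℝ g x} := measurableSet_of_differentiableAt ℝ g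
  have hae : ∀ᵐ x ∂μ, DifferentiableAt ℝ g x := hK.ae_differentiableAt
  have h1 : ∀ᵐ x ∂μ, ∀ᵐ τ : ℝ, DifferentiableAt ℝ g (x + τ • z) := by
    rw [Measure.ae_ae_comm]
    · refine ae_of_all _ fun τ => ?_
      exact (measurePreserving_add_right μ (τ • z)).quasiMeasurePreserving.ae hae
    · exact hD.preimage (f := fun p : E × ℝ => p.1 + p.2 • z)
        (by fun_prop : Continuous fun p : E × ℝ => p.1 + p.2 • z).measurable
  have h2 : ∀ᵐ x ∂μ, g (x + z) ≤ g x * Real.exp (C * ‖z‖) := by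
    filter_upwards [h1] with x hx
    have hl : LipschitzWith (K * ‖z‖₊) (fun τ : ℝ => g (x + τ • z)) := by
      apply hK.comp
      apply LipschitzWith.of_dist_le_mul
      intro a b
      rw [dist_add_left, dist_eq_norm, ← sub_smul, norm_smul, mul_comm, Real.dist_eq]
      simp
    have := le_mul_exp_of_ae_abs_deriv_le hl (c := C * ‖z‖) ?_
    · simpa using this
    filter_upwards [hx] with τ hτ
    have h3 : HasDerivAt (fun τ : ℝ => x + τ • z) z τ := by
      simpa using ((hasDerivAt_id τ).smul_const z).const_add x
    have h4 := hτ.hasFDerivAt.comp_hasDerivAt τ h3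
    have h5 : deriv (fun τ : ℝ => g (x + τ • z)) τ = fderiv ℝ g (x + τ • z) z := h4.deriv
    rw [h5, ← Real.norm_eq_abs]
    calc _ ≤ ‖fderiv ℝ g (x + τ • z)‖ * ‖z‖ := ContinuousLinearMap.le_opNorm _ _
      _ ≤ (C * g (x + τ • z)) * ‖z‖ := by gcongr; exact hd _ hτ
      _ = _ := by ring
  have hcl : IsClosed {x | g (x + z) ≤ g x * Real.exp (C * ‖z‖)} := by
    have := hK.continuous
    exact isClosed_le (by fun_prop) (by fun_prop)
  have hdense : Dense {x | g (x + z) ≤ g x * Real.exp (C * ‖z‖)} := Measure.dense_of_ae h2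
  have := hcl.closure_eq ▸ hdense x
  exact this

end Kernel

/-! ### Maximum principle for weighted averages -/

section MaximumPrinciple

variable {X : Type*} [MeasurableSpace X] {Q : Measure X} [IsProbabilityMeasure Q]

/-- With `a = ∫k`, the bound obtained for `c` is the convex combination of `P/δ` and `M` with weight
`λa/(δ + λa)` on `M`. As `P/δ ≤ M`, it increases with `a`, so `a` may be replaced by `H`. -/
theorem le_of_weighted_average {f k : X → ℝ} {δ lam P H M c : ℝ}
    (hδ : 0 < δ) (hlam : 0 ≤ lam) (hk : Measurable k) (hk0 : ∀ y, 0 ≤ k y) (hkH : ∀ y, k y ≤ H)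
    (hf : Integrable f Q) (hM : ∀ᵐ y ∂Q, f y ≤ M) (hPM : P ≤ δ * M)
    (h : (δ + lam * ∫ y, k y ∂Q) * c ≤ P + lam * ∫ y, k y * f y ∂Q) :
    c ≤ (P + lam * H * M) / (δ + lam * H) := by
  have hkn : ∀ y, ‖k y‖ ≤ H := fun y => by rw [Real.norm_eq_abs, abs_of_nonneg (hk0 y)]; exact hkH y
  have hki : Integrable k Q := Integrable.of_bound hk.aestronglyMeasurable H (ae_of_all _ hkn)
  set a := ∫ y, k y ∂Q with ha
  have ha0 : 0 ≤ a := integral_nonneg hk0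
  have haH : a ≤ H := by
    have := integral_mono hki (integrable_const H) hkH
    simpa using this
  have h1 : ∫ y, k y * f y ∂Q ≤ a * M := by
    rw [ha, ← integral_mul_const]
    apply integral_mono_ae
    · exact hf.bdd_mul hk.aestronglyMeasurable (ae_of_all _ hkn)
    · exact hki.mul_const M
    · filter_upwards [hM] with y hy
      exact mul_le_mul_of_nonneg_left hy (hk0 y)
  have hH : 0 ≤ H := ha0.trans haH
  have hp : 0 < δ + lam * H := by positivity
  have hp' : 0 < δ + lam * a := by positivity
  have h2 : c ≤ (P + lam * a * M) / (δ + lam * a) := by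
    rw [le_div_iff₀ hp']
    nlinarith [mul_le_mul_of_nonneg_left h1 hlam]
  refine h2.trans ?_
  rw [div_le_div_iff₀ hp' hp]
  nlinarith [mul_nonneg (mul_nonneg hlam (sub_nonneg.2 haH)) (sub_nonneg.2 hPM)]

/-- `P/δ` is the fixed point of `M ↦ (P + λHM)/(δ + λH)`. This form passes from almost every curve
to each individual curve of the support. -/
theorem le_div_of_weighted_average {f k : X → ℝ} {δ lam P H c : ℝ}
    (hδ : 0 < δ) (hlam : 0 ≤ lam) (hk : Measurable k) (hk0 : ∀ y, 0 ≤ k y) (hkH : ∀ y, k y ≤ H)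
    (hf : Integrable f Q) (hM : ∀ᵐ y ∂Q, f y ≤ P / δ)
    (h : (δ + lam * ∫ y, k y ∂Q) * c ≤ P + lam * ∫ y, k y * f y ∂Q) : c ≤ P / δ := by
  have h1 := le_of_weighted_average hδ hlam hk hk0 hkH hf hM (by field_simp; exact le_rfl) h
  have hH : 0 ≤ H := by
    obtain ⟨y⟩ : Nonempty X := Q.nonempty_of_neZero
    exact (hk0 y).trans (hkH y)
  have hp : 0 < δ + lam * H := by positivity
  convert h1 using 1
  field_simp

/-- The `L¹` norm of `f` gives a first essential bound. Each further use of the averaged inequality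
contracts the excess over `P/δ` by the factor `θ = λH/(δ + λH) < 1`. -/
theorem ae_le_of_ae_le_weighted_average {f : X → ℝ} {k : X → X → ℝ} {δ lam P H : ℝ}
    (hδ : 0 < δ) (hlam : 0 ≤ lam) (hk : ∀ x, Measurable (k x)) (hk0 : ∀ x y, 0 ≤ k x y)
    (hkH : ∀ x y, k x y ≤ H) (hf : Integrable f Q) (hf0 : ∀ y, 0 ≤ f y)
    (h : ∀ᵐ x ∂Q, (δ + lam * ∫ y, k x y ∂Q) * f x ≤ P + lam * ∫ y, k x y * f y ∂Q) :
    ∀ᵐ x ∂Q, f x ≤ P / δ := by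
  have hH : 0 ≤ H := by
    obtain ⟨y⟩ : Nonempty X := Q.nonempty_of_neZero
    exact (hk0 y y).trans (hkH y y)
  have hp : 0 < δ + lam * H := by positivity
  set M := (P + lam * (H * ∫ y, f y ∂Q)) / δ
  have hM : ∀ᵐ x ∂Q, f x ≤ M := by
    filter_upwards [h] with x hx
    rw [le_div_iff₀ hδ]
    have h1 : ∫ y, k x y * f y ∂Q ≤ H * ∫ y, f y ∂Q := by
      rw [← integral_const_mul]
      apply integral_mono_of_nonneg
      · exact ae_of_all _ fun y => mul_nonneg (hk0 x y) (hf0 y)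
      · exact hf.const_mul H
      · exact ae_of_all _ fun y => mul_le_mul_of_nonneg_right (hkH x y) (hf0 y)
    have h2 : 0 ≤ lam * (∫ y, k x y ∂Q) * f x :=
      mul_nonneg (mul_nonneg hlam (integral_nonneg (hk0 x))) (hf0 x)
    have h3 := mul_le_mul_of_nonneg_left h1 hlam
    linarith
  set θ := lam * H / (δ + lam * H) with hθ
  have hθ0 : 0 ≤ θ := by positivity
  have hθ1 : θ < 1 := by rw [hθ, div_lt_one hp]; linarith
  set M' := |M - P / δ|
  have hstep : ∀ n : ℕ, ∀ᵐ x ∂Q, f x ≤ P / δ + θ ^ n * M' := by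
    intro n
    induction n with
    | zero =>
      filter_upwards [hM] with x hx
      have := le_abs_self (M - P / δ)
      simp only [pow_zero, one_mul]
      change f x ≤ P / δ + |M - P / δ|
      linarith
    | succ n ih =>
      filter_upwards [h] with x hx
      have h0 : 0 ≤ θ ^ n * M' := by positivity
      have := le_of_weighted_average hδ hlam (hk x) (hk0 x) (hkH x) hf ih
        (by
          have : δ * (P / δ + θ ^ n * M') = P + δ * (θ ^ n * M') := by field_simp
          rw [this]; nlinarith) hx
      refine this.trans (le_of_eq ?_)
      rw [pow_succ, hθ]
      field_simp
      ring
  rw [← ae_all_iff] at hstep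
  filter_upwards [hstep] with x hx
  have ht : Filter.Tendsto (fun n : ℕ => P / δ + θ ^ n * M') Filter.atTop (nhds (P / δ + 0 * M')) :=
    ((tendsto_pow_atTop_nhds_zero_of_lt_one hθ0 hθ1).mul_const _).const_add _
  simpa using ge_of_tendsto' ht hx

/-- Solves the momentum relation for `x`: the terms in `x` are collected on one side, so the
averages of `f` act as a source. -/
theorem weighted_average_norm_le {E : Type*} [NormedAddCommGroup E] [NormedSpace ℝ E]
    [CompleteSpace E] {f : X → E} {k : X → ℝ} {δ lam H : ℝ} (hδ : 0 < δ) (hlam : 0 ≤ lam)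
    (hk : Measurable k) (hk0 : ∀ y, 0 ≤ k y) (hkH : ∀ y, k y ≤ H) (hf : Integrable f Q) (x : E) :
    (δ + lam * ∫ y, k y ∂Q) * ‖x‖ ≤
      ‖δ • x + lam • ∫ y, k y • (x - f y) ∂Q‖ + lam * ∫ y, k y * ‖f y‖ ∂Q := by
  have hkn : ∀ y, ‖k y‖ ≤ H := fun y => by rw [Real.norm_eq_abs, abs_of_nonneg (hk0 y)]; exact hkH y
  have hki : Integrable k Q := Integrable.of_bound hk.aestronglyMeasurable H (ae_of_all _ hkn)
  have hkf : Integrable (fun y => k y • f y) Q :=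
    hf.bdd_smul H hk.aestronglyMeasurable (ae_of_all _ hkn)
  have h1 : ∫ y, k y • (x - f y) ∂Q = (∫ y, k y ∂Q) • x - ∫ y, k y • f y ∂Q := by
    simp_rw [smul_sub]
    rw [integral_sub (hki.smul_const x) hkf, integral_smul_const]
  have ha0 : 0 ≤ ∫ y, k y ∂Q := integral_nonneg hk0
  have h2 : (δ + lam * ∫ y, k y ∂Q) • x = (δ • x + lam • ∫ y, k y • (x - f y) ∂Q) +
      lam • ∫ y, k y • f y ∂Q := by
    rw [h1, add_smul, smul_sub, mul_smul]
    abel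
  have h3 : ‖∫ y, k y • f y ∂Q‖ ≤ ∫ y, k y * ‖f y‖ ∂Q := by
    refine (norm_integral_le_integral_norm _).trans (le_of_eq ?_)
    refine integral_congr_ae (ae_of_all _ fun y => ?_)
    simp only
    rw [norm_smul, Real.norm_eq_abs, abs_of_nonneg (hk0 y)]
  calc (δ + lam * ∫ y, k y ∂Q) * ‖x‖ = ‖(δ + lam * ∫ y, k y ∂Q) • x‖ := by
        rw [norm_smul, Real.norm_eq_abs, abs_of_nonneg (by positivity)]
    _ ≤ _ := by
        rw [h2]
        refine (norm_add_le _ _).trans ?_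
        gcongr
        rw [norm_smul, Real.norm_eq_abs, abs_of_nonneg hlam]
        gcongr

end MaximumPrinciple

/-! ### From integral bounds to pointwise bounds in time -/

section OneDimensional

theorem MeasureTheory.IntegrableOn.intervalIntegrable_of_mem_Icc {E : Type*}
    [NormedAddCommGroup E] {T : ℝ} {p : ℝ → E} (hp : IntegrableOn p (Icc 0 T))
    {a b : ℝ} (ha : a ∈ Icc 0 T) (hb : b ∈ Icc 0 T) : IntervalIntegrable p volume a b :=
  (hp.mono_set (uIcc_subset_Icc ha hb)).intervalIntegrable

open Filter Topology

variable {E : Type*} [NormedAddCommGroup E] [InnerProductSpace ℝ E] [CompleteSpace E] {T : ℝ}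

/-- Lebesgue's differentiation theorem on `(0,T)`. -/
theorem ae_mem_Ioo_hasDerivAt_integral (hT : 0 < T) {p : ℝ → E}
    (hp : IntegrableOn p (Icc 0 T)) :
    ∀ᵐ x ∂volume.restrict (Icc 0 T), x ∈ Ioo 0 T ∧
      HasDerivAt (fun x => ∫ t in (0 : ℝ)..x, p t) (p x) x := by
  have h1 : IntervalIntegrable p volume 0 T := by
    rw [intervalIntegrable_iff_integrableOn_Icc_of_le hT.le]; exact hp
  have h2 : ∀ᵐ x : ℝ, x ≠ 0 := by simp [ae_iff]
  have h3 : ∀ᵐ x : ℝ, x ≠ T := by simp [ae_iff]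
  rw [ae_restrict_iff' measurableSet_Icc]
  filter_upwards [h1.ae_hasDerivAt_integral, h2, h3] with x hx hx0 hxT hxI
  rw [uIcc_of_le hT.le] at hx
  exact ⟨⟨lt_of_le_of_ne hxI.1 hx0.symm, lt_of_le_of_ne hxI.2 hxT⟩, hx hxI 0 ⟨le_rfl, hT.le⟩⟩

theorem ae_norm_le_of_norm_integral_le (hT : 0 < T) {p : ℝ → E} (hp : IntegrableOn p (Icc 0 T))
    {P : ℝ} (hP : 0 ≤ P)
    (h : ∀ s t, 0 ≤ s → s ≤ t → t ≤ T → ‖∫ x in s..t, p x‖ ≤ P * (t - s)) :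
    ∀ᵐ x ∂volume.restrict (Icc 0 T), ‖p x‖ ≤ P := by
  filter_upwards [ae_mem_Ioo_hasDerivAt_integral hT hp] with x hx
  have hl : LipschitzOnWith ⟨P, hP⟩ (fun x => ∫ t in (0 : ℝ)..x, p t) (Icc 0 T) := by
    apply LipschitzOnWith.of_dist_le_mul
    intro a ha b hb
    have h0 : (0 : ℝ) ∈ Icc 0 T := ⟨le_rfl, hT.le⟩
    rw [dist_eq_norm, intervalIntegral.integral_interval_sub_left
      (hp.intervalIntegrable_of_mem_Icc h0 ha) (hp.intervalIntegrable_of_mem_Icc h0 hb)]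
    simp only [Real.dist_eq]
    rcases le_total a b with hab | hab
    · rw [intervalIntegral.integral_symm, norm_neg, abs_sub_comm, abs_of_nonneg (sub_nonneg.2 hab)]
      exact h a b ha.1 hab hb.2
    · rw [abs_of_nonneg (sub_nonneg.2 hab)]
      exact h b a hb.1 hab ha.2
  exact hx.2.le_of_lipschitzOn (Icc_mem_nhds hx.1.1 hx.1.2) hl

/-- Divide by `r` and let `r → 0` at Lebesgue points: the window integrals become values of `p`.
Only disjoint windows are needed, and the length `t + r - s` of their hull tends to `t - s`. -/
theorem ae_norm_sub_le_of_norm_integral_sub_le (hT : 0 < T) {p : ℝ → E}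
    (hp : IntegrableOn p (Icc 0 T)) {P : ℝ}
    (h : ∀ s t r, 0 ≤ s → 0 ≤ r → s + r ≤ t → t + r ≤ T →
      ‖(∫ x in s..(s + r), p x) - ∫ x in t..(t + r), p x‖ ≤ P * r * (t + r - s)) :
    ∀ᵐ z ∂(volume.restrict (Icc 0 T)).prod (volume.restrict (Icc 0 T)),
      ‖p z.1 - p z.2‖ ≤ P * |z.1 - z.2| := by
  set g := fun x => ∫ t in (0 : ℝ)..x, p t with hg
  have hgood := ae_mem_Ioo_hasDerivAt_integral hT hp
  have key : ∀ s t, s < t → (s ∈ Ioo 0 T ∧ HasDerivAt g (p s) s) →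
      (t ∈ Ioo 0 T ∧ HasDerivAt g (p t) t) → ‖p s - p t‖ ≤ P * |s - t| := by
    intro s t hst hs ht
    have h1 := (hs.2.tendsto_slope_zero_right.sub ht.2.tendsto_slope_zero_right).norm
    have h2 : Tendsto (fun r : ℝ => P * (t + r - s)) (𝓝[>] 0) (𝓝 (P * (t + 0 - s))) := by
      apply Tendsto.mono_left _ nhdsWithin_le_nhds
      exact Continuous.tendsto (by fun_prop) _
    have hev : ∀ᶠ r in 𝓝[>] (0 : ℝ), r < t - s ∧ r < T - t ∧ 0 < r := by
      have e1 : ∀ᶠ r in 𝓝[>] (0 : ℝ), r < t - s :=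
        nhdsWithin_le_nhds (Iio_mem_nhds (by linarith))
      have e2 : ∀ᶠ r in 𝓝[>] (0 : ℝ), r < T - t :=
        nhdsWithin_le_nhds (Iio_mem_nhds (by linarith [ht.1.2]))
      filter_upwards [e1, e2, self_mem_nhdsWithin] with r h1 h2 h3 using ⟨h1, h2, h3⟩
    have h3 := le_of_tendsto_of_tendsto h1 h2 (by
      filter_upwards [hev] with r hr
      have m0 : (0 : ℝ) ∈ Icc 0 T := ⟨le_rfl, hT.le⟩
      have mem : ∀ y, 0 ≤ y → y ≤ T → y ∈ Icc 0 T := fun y a b => ⟨a, b⟩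
      have i : ∀ y, 0 ≤ y → y ≤ T → IntervalIntegrable p volume 0 y := fun y a b =>
        hp.intervalIntegrable_of_mem_Icc m0 ⟨a, b⟩
      have hs1 := hs.1.1
      have ht1 := ht.1.1
      rw [← smul_sub, norm_smul, Real.norm_eq_abs, abs_of_pos (inv_pos.2 hr.2.2), hg]
      simp only
      rw [intervalIntegral.integral_interval_sub_left
        (i _ (by linarith) (by linarith)) (i _ (by linarith) (by linarith)),
        intervalIntegral.integral_interval_sub_left
        (i _ (by linarith) (by linarith)) (i _ (by linarith) (by linarith))]
      have := h s t r hs1.le hr.2.2.le (by linarith) (by linarith)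
      rw [inv_mul_le_iff₀ hr.2.2]
      linarith)
    rw [abs_sub_comm, abs_of_pos (sub_pos.2 hst)]
    simpa using h3
  have g1 := Measure.quasiMeasurePreserving_fst (μ := volume.restrict (Icc 0 T))
    (ν := volume.restrict (Icc 0 T)) |>.ae hgood
  have g2 := Measure.quasiMeasurePreserving_snd (μ := volume.restrict (Icc 0 T))
    (ν := volume.restrict (Icc 0 T)) |>.ae hgood
  filter_upwards [g1, g2] with z hz1 hz2
  rcases lt_trichotomy z.1 z.2 with hlt | heq | hgt
  · exact key _ _ hlt hz1 hz2
  · simp [heq]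
  · rw [norm_sub_rev, abs_sub_comm]
    exact key _ _ hgt hz2 hz1

/-- A map which is Lipschitz along almost every pair of points of `[0,T]` has a Lipschitz
representative. -/
theorem exists_lipschitzWith_ae_eq {E : Type*} [NormedAddCommGroup E] [NormedSpace ℝ E]
    [FiniteDimensional ℝ E] {T : ℝ} {u : ℝ → E} {L : ℝ≥0}
    (h : ∀ᵐ z ∂(volume.restrict (Icc 0 T)).prod (volume.restrict (Icc 0 T)),
      ‖u z.1 - u z.2‖ ≤ L * |z.1 - z.2|) :
    ∃ g : ℝ → E, LipschitzWith (lipschitzExtensionConstant E * L) g ∧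
      u =ᵐ[volume.restrict (Icc 0 T)] g := by
  have h1 := Measure.ae_ae_of_ae_prod h
  -- Two points of `S` are compared through a generic `t` between them, where the two distances add
  -- up exactly, so the constant `L` is kept.
  set S := {s | s ∈ Icc 0 T ∧ ∀ᵐ t ∂volume.restrict (Icc 0 T), ‖u s - u t‖ ≤ L * |s - t|}
  have key : ∀ s ∈ S, ∀ s' ∈ S, s < s' → ‖u s - u s'‖ ≤ L * |s - s'| := by
    intro s hs s' hs' hlt
    have hsub : Ioo s s' ⊆ Icc 0 T := fun y hy => ⟨hs.1.1.trans hy.1.le, hy.2.le.trans hs'.1.2⟩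
    have h2 : ∀ᵐ t ∂volume.restrict (Ioo s s'), t ∈ Ioo s s' ∧ ‖u s - u t‖ ≤ L * |s - t| ∧
        ‖u s' - u t‖ ≤ L * |s' - t| := by
      filter_upwards [ae_restrict_mem measurableSet_Ioo,
        ae_restrict_of_ae_restrict_of_subset hsub hs.2,
        ae_restrict_of_ae_restrict_of_subset hsub hs'.2] with t a b c using ⟨a, b, c⟩
    have : (ae (volume.restrict (Ioo s s'))).NeBot := by
      rw [ae_neBot, ne_eq, Measure.restrict_eq_zero]
      simp [hlt]
    obtain ⟨t, ht, ha, hb⟩ := h2.exists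
    rw [abs_sub_comm, abs_of_pos (sub_pos.2 ht.1)] at ha
    rw [abs_of_pos (sub_pos.2 ht.2)] at hb
    rw [abs_sub_comm, abs_of_pos (sub_pos.2 hlt)]
    calc ‖u s - u s'‖ = ‖(u s - u t) - (u s' - u t)‖ := by congr 1; abel
      _ ≤ ‖u s - u t‖ + ‖u s' - u t‖ := norm_sub_le _ _
      _ ≤ _ := by linarith
  have hL : LipschitzOnWith L u S := by
    apply LipschitzOnWith.of_dist_le_mul
    intro a ha b hb
    rw [dist_eq_norm, Real.dist_eq]
    rcases lt_trichotomy a b with hlt | heq | hgt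
    · exact key _ ha _ hb hlt
    · simp [heq]
    · rw [norm_sub_rev, abs_sub_comm]
      exact key _ hb _ ha hgt
  obtain ⟨g, hg, hgS⟩ := hL.extend_finite_dimension
  refine ⟨g, hg, ?_⟩
  filter_upwards [h1, ae_restrict_mem measurableSet_Icc] with s hs hsI
  exact hgS ⟨hsI, hs⟩

end OneDimensional

/-! ### Consequences of the weak Euler-Lagrange inequality -/

section Variational

variable {E : Type*} [NormedAddCommGroup E] [InnerProductSpace ℝ E] [CompleteSpace E] {T : ℝ}

theorem intervalIntegral_indicator_Ioc_const {s t x : ℝ} (hs : 0 ≤ s) (hx : 0 ≤ x) (c : E) :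
    ∫ y in (0 : ℝ)..x, (Ioc s t).indicator (fun _ => c) y = max (min x t - s) 0 • c := by
  rw [intervalIntegral.integral_of_le hx, setIntegral_indicator measurableSet_Ioc,
    Ioc_inter_Ioc, setIntegral_const, Real.volume_real_Ioc, sup_of_le_right hs]

theorem setIntegral_inner_indicator_Ioc {p : ℝ → E} (hp : IntegrableOn p (Icc 0 T)) {s t : ℝ}
    (hs : 0 ≤ s) (hst : s ≤ t) (ht : t ≤ T) (c : E) :
    IntegrableOn (fun x => inner ℝ (p x) ((Ioc s t).indicator (fun _ => c) x)) (Icc 0 T) ∧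
    ∫ x in Icc 0 T, inner ℝ (p x) ((Ioc s t).indicator (fun _ => c) x) =
      inner ℝ (∫ x in s..t, p x) c := by
  have hsub : Ioc s t ⊆ Icc 0 T := fun y hy => ⟨hs.trans hy.1.le, hy.2.trans ht⟩
  have h1 : (fun x => inner ℝ (p x) ((Ioc s t).indicator (fun _ => c) x)) =
      (Ioc s t).indicator (fun x => inner ℝ (p x) c) := by
    ext x
    by_cases hx : x ∈ Ioc s t <;> simp [hx]
  rw [h1]
  refine ⟨(hp.inner_const c).indicator measurableSet_Ioc, ?_⟩
  rw [setIntegral_indicator measurableSet_Ioc, inter_eq_self_of_subset_right hsub,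
    intervalIntegral.integral_of_le hst, real_inner_comm, ← integral_inner (hp.mono_set hsub)]
  simp_rw [real_inner_comm]

variable [MeasurableSpace E] {p : ℝ → E} {e : ℝ → ℝ} {ℓ κ : ℝ}

/-- A vector field `p` on `[0,T]` satisfies, in the weak sense, `|p'| ≤ κ e` and `|p(T)| ≤ ℓ`. -/
def WeakEulerLagrange (T : ℝ) (p : ℝ → E) (e : ℝ → ℝ) (ℓ κ : ℝ) : Prop :=
  ∀ ψ : ℝ → E, Measurable ψ → (∃ M, ∀ x, ‖ψ x‖ ≤ M) →
    -∫ x in Icc 0 T, inner ℝ (p x) (ψ x) ≤ ℓ * ‖∫ y in (0 : ℝ)..T, ψ y‖ +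
      κ * ∫ x in Icc 0 T, e x * ‖∫ y in (0 : ℝ)..x, ψ y‖

/-- Test with `-v` on `(s,t]`, where `v = ∫ₛᵗ p`: the left side is `|v|²`, while the displacement
never exceeds `(t - s)|v|`. Dividing by `|v|` bounds the mean of `p` on every interval. -/
theorem WeakEulerLagrange.ae_norm_le (h : WeakEulerLagrange T p e ℓ κ) (hT : 0 < T)
    (hp : IntegrableOn p (Icc 0 T)) (he : IntegrableOn e (Icc 0 T)) (he0 : ∀ x, 0 ≤ e x)
    (hl : 0 ≤ ℓ) (hκ : 0 ≤ κ) :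
    ∀ᵐ x ∂volume.restrict (Icc 0 T), ‖p x‖ ≤ ℓ + κ * ∫ x in Icc 0 T, e x := by
  have hei : 0 ≤ ∫ x in Icc 0 T, e x := integral_nonneg he0
  refine ae_norm_le_of_norm_integral_le hT hp (by positivity) fun s t hs hst ht => ?_
  set v := ∫ x in s..t, p x with hv
  have h1 := h ((Ioc s t).indicator fun _ => -v) (measurable_const.indicator measurableSet_Ioc)
    ⟨‖v‖, fun x => (norm_indicator_le_norm_self _ _).trans (by simp)⟩
  rw [(setIntegral_inner_indicator_Ioc hp hs hst ht (-v)).2, ← hv, inner_neg_right, neg_neg,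
    real_inner_self_eq_norm_sq] at h1
  have hφ : ∀ x, 0 ≤ x → ‖∫ y in (0 : ℝ)..x, (Ioc s t).indicator (fun _ => -v) y‖
      ≤ (t - s) * ‖v‖ := by
    intro x hx
    rw [intervalIntegral_indicator_Ioc_const hs hx, norm_smul, norm_neg, Real.norm_eq_abs,
      abs_of_nonneg (le_max_right _ _)]
    gcongr
    exact max_le (by linarith [min_le_right x t]) (by linarith)
  have h2 : ∫ x in Icc 0 T, e x * ‖∫ y in (0 : ℝ)..x, (Ioc s t).indicator (fun _ => -v) y‖ ≤
      (∫ x in Icc 0 T, e x) * ((t - s) * ‖v‖) := by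
    rw [← integral_mul_const]
    apply integral_mono_of_nonneg
    · exact ae_of_all _ fun x => mul_nonneg (he0 x) (norm_nonneg _)
    · exact he.mul_const _
    · filter_upwards [ae_restrict_mem measurableSet_Icc] with x hx
      exact mul_le_mul_of_nonneg_left (hφ x hx.1) (he0 x)
  have h3 : ‖v‖ * ‖v‖ ≤ ((ℓ + κ * ∫ x in Icc 0 T, e x) * (t - s)) * ‖v‖ := by
    calc ‖v‖ * ‖v‖ = ‖v‖ ^ 2 := by ring
      _ ≤ _ := h1
      _ ≤ ℓ * ((t - s) * ‖v‖) + κ * ((∫ x in Icc 0 T, e x) * ((t - s) * ‖v‖)) := by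
        gcongr
        exact hφ T hT.le
      _ = _ := by ring
  rcases (norm_nonneg v).eq_or_lt with h0 | h0
  · rw [← h0]
    have := sub_nonneg.2 hst
    positivity
  · exact le_of_mul_le_mul_right h3 h0

theorem WeakEulerLagrange.ae_norm_sub_le [BorelSpace E] (h : WeakEulerLagrange T p e ℓ κ) (hT : 0 < T)
    (hp : IntegrableOn p (Icc 0 T)) (he0 : ∀ x, 0 ≤ e x) {E₀ : ℝ}
    (hE : ∀ᵐ x ∂volume.restrict (Icc 0 T), e x ≤ E₀) (hκ : 0 ≤ κ) :
    ∀ᵐ z ∂(volume.restrict (Icc 0 T)).prod (volume.restrict (Icc 0 T)),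
      ‖p z.1 - p z.2‖ ≤ κ * E₀ * |z.1 - z.2| := by
  refine ae_norm_sub_le_of_norm_integral_sub_le hT hp fun s t r hs hr hst ht => ?_
  have hE0 : 0 ≤ E₀ := by
    have : (ae (volume.restrict (Icc 0 T))).NeBot := by
      rw [ae_neBot, ne_eq, Measure.restrict_eq_zero]
      simp [hT]
    obtain ⟨x, hx⟩ := hE.exists
    exact (he0 x).trans hx
  set v := (∫ x in s..(s + r), p x) - ∫ x in t..(t + r), p x with hv
  -- The displacement is a trapezoid of height at most `r|v|` supported in `[s, t + r]`. It returns
  -- to zero before `T`, so the final cost does not enter.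
  set ψ : ℝ → E := fun x => (Ioc s (s + r)).indicator (fun _ => -v) x +
    (Ioc t (t + r)).indicator (fun _ => v) x with hψ
  have i1 := setIntegral_inner_indicator_Ioc hp hs (t := s + r) (by linarith) (by linarith) (-v)
  have i2 := setIntegral_inner_indicator_Ioc hp (s := t) (t := t + r) (by linarith) (by linarith)
    ht v
  have hφe : ∀ x, 0 ≤ x → ∫ y in (0 : ℝ)..x, ψ y =
      (max (min x (t + r) - t) 0 - max (min x (s + r) - s) 0) • v := by
    intro x hx
    have int : ∀ a b : ℝ, ∀ c : E, IntervalIntegrable ((Ioc a b).indicator fun _ => c)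
        volume 0 x := fun a b c => by
      refine Integrable.intervalIntegrable ?_
      exact (integrable_indicator_iff measurableSet_Ioc).2 (by simp)
    rw [hψ, intervalIntegral.integral_add (int _ _ _) (int _ _ _),
      intervalIntegral_indicator_Ioc_const hs hx,
      intervalIntegral_indicator_Ioc_const (by linarith) hx, smul_neg, sub_smul]
    abel
  have hφ : ∀ x, 0 ≤ x → ‖∫ y in (0 : ℝ)..x, ψ y‖ ≤
      (Icc s (t + r)).indicator (fun _ => r * ‖v‖) x := by
    intro x hx
    rw [hφe x hx, norm_smul, Real.norm_eq_abs]
    by_cases hxm : x ∈ Icc s (t + r)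
    · rw [indicator_of_mem hxm]
      gcongr
      rw [abs_le]
      have a1 : max (min x (t + r) - t) 0 ≤ r := max_le (by linarith [min_le_right x (t + r)]) hr
      have a2 : max (min x (s + r) - s) 0 ≤ r := max_le (by linarith [min_le_right x (s + r)]) hr
      have a3 := le_max_right (min x (t + r) - t) 0
      have a4 := le_max_right (min x (s + r) - s) 0
      constructor <;> linarith
    · rw [indicator_of_notMem hxm]
      rw [mem_Icc, not_and_or, not_le, not_le] at hxm
      rcases hxm with hxm | hxm
      · rw [max_eq_right (by linarith [min_le_left x (t + r)]),
          max_eq_right (by linarith [min_le_left x (s + r)])]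
        simp
      · rw [min_eq_right hxm.le, min_eq_right (by linarith : s + r ≤ x)]
        simp
  have hφT : ∫ y in (0 : ℝ)..T, ψ y = 0 := by
    rw [hφe T hT.le, min_eq_right ht, min_eq_right (by linarith : s + r ≤ T)]
    simp
  have h1 := h ψ (by fun_prop (disch := exact measurableSet_Ioc)) ⟨‖v‖ + ‖v‖, fun x => by
    refine (norm_add_le _ _).trans (add_le_add ?_ ?_)
    · exact (norm_indicator_le_norm_self _ _).trans (by simp)
    · exact norm_indicator_le_norm_self _ _⟩
  rw [hφT] at h1
  simp only [hψ, inner_add_right] at h1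
  rw [integral_add i1.1 i2.1, i1.2, i2.2] at h1
  have h1' : ‖v‖ ^ 2 ≤ κ * ∫ x in Icc 0 T, e x * ‖∫ y in (0 : ℝ)..x, ψ y‖ := by
    have : -(inner ℝ (∫ x in s..(s + r), p x) (-v) + inner ℝ (∫ x in t..(t + r), p x) v) =
        ‖v‖ ^ 2 := by
      rw [← real_inner_self_eq_norm_sq, inner_neg_right]
      conv_rhs => rw [hv, inner_sub_left, ← hv]
      ring
    rw [← this]
    simpa using h1
  have h2 : ∫ x in Icc 0 T, e x * ‖∫ y in (0 : ℝ)..x, ψ y‖ ≤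
      ∫ x in Icc 0 T, (Icc s (t + r)).indicator (fun _ => E₀ * (r * ‖v‖)) x := by
    apply integral_mono_of_nonneg
    · exact ae_of_all _ fun x => mul_nonneg (he0 x) (norm_nonneg _)
    · exact (integrable_indicator_iff measurableSet_Icc).2
        (integrableOn_const (measure_ne_top _ _))
    · filter_upwards [ae_restrict_mem measurableSet_Icc, hE] with x hx hxE
      refine (mul_le_mul_of_nonneg_left (hφ x hx.1) (he0 x)).trans ?_
      by_cases hxm : x ∈ Icc s (t + r)
      · simp only [indicator_of_mem hxm]
        gcongr
      · simp [indicator_of_notMem hxm]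
  have h3 : ∫ x in Icc 0 T, (Icc s (t + r)).indicator (fun _ => E₀ * (r * ‖v‖)) x =
      (t + r - s) * (E₀ * (r * ‖v‖)) := by
    rw [setIntegral_indicator measurableSet_Icc, inter_eq_self_of_subset_right
      (Icc_subset_Icc hs ht), setIntegral_const, Real.volume_real_Icc,
      max_eq_left (by linarith), smul_eq_mul]
  rw [h3] at h2
  have h4 : ‖v‖ * ‖v‖ ≤ (κ * E₀ * r * (t + r - s)) * ‖v‖ := by
    calc ‖v‖ * ‖v‖ = ‖v‖ ^ 2 := by ring
      _ ≤ _ := h1'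
      _ ≤ κ * ((t + r - s) * (E₀ * (r * ‖v‖))) := by gcongr
      _ = _ := by ring
  rcases (norm_nonneg v).eq_or_lt with h0 | h0
  · rw [← h0]
    have : 0 ≤ t + r - s := by linarith
    positivity
  · exact le_of_mul_le_mul_right h4 h0

end Variational

/-! ### Curves in `ℝ^d` and in the torus, treated together -/

/-- A flat covering `ℝ^d → Ω`: a `1`-Lipschitz homomorphism with a measurable section which is
the identity near the origin. -/
structure IsFlatCover {d : ℕ} {Ω : Type} [NormedAddCommGroup Ω] [MeasurableSpace Ω]
    (π : Eucl d → Ω) : Prop where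
  map_add : ∀ x y, π (x + y) = π x + π y
  lipschitz : LipschitzWith 1 π
  exists_section : ∃ s : Ω → Eucl d, Measurable s ∧ (∀ x, π (s x) = x) ∧
    ∃ r > 0, ∀ y, ‖y‖ < r → s (π y) = y

section Cover

open Filter Topology

variable {d : ℕ} {Ω : Type} [NormedAddCommGroup Ω] {T : ℝ}

/-- The extension of a curve to the real line, constant outside `[0,T]`. -/
noncomputable def evalAt (hT : 0 ≤ T) (γ : Curve Ω T) (t : ℝ) : Ω := γ (projIcc 0 T hT t)

theorem continuous_evalAt (hT : 0 ≤ T) :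
    Continuous fun p : Curve Ω T × ℝ => evalAt hT p.1 p.2 := by
  unfold evalAt
  have : Continuous fun p : Curve Ω T × ℝ => projIcc 0 T hT p.2 :=
    continuous_projIcc.comp continuous_snd
  fun_prop

theorem HasL2Velocity.intervalIntegrable {π : Eucl d → Ω} {γ : Curve Ω T} {v : ℝ → Eucl d}
    (h : HasL2Velocity π γ v) {a b : ℝ} (ha : a ∈ Icc 0 T) (hb : b ∈ Icc 0 T) :
    IntervalIntegrable v volume a b :=
  (show IntegrableOn v (Icc 0 T) volume from
    h.1.integrable (by norm_num)).intervalIntegrable_of_mem_Icc ha hb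

theorem HasL2Velocity.congr {π : Eucl d → Ω} {γ : Curve Ω T} {v w : ℝ → Eucl d}
    (h : HasL2Velocity π γ v) (hvw : v =ᵐ[volume.restrict (Icc 0 T)] w) :
    HasL2Velocity π γ w := by
  obtain ⟨x₀, hx⟩ := h.2
  refine ⟨h.1.ae_eq hvw, x₀, fun t => ?_⟩
  rw [hx t]
  congr 2
  rw [intervalIntegral.integral_of_le t.2.1, intervalIntegral.integral_of_le t.2.1]
  apply integral_congr_ae
  have hsub : Ioc 0 (t : ℝ) ⊆ Icc 0 T := fun y hy => ⟨hy.1.le, hy.2.trans t.2.2⟩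
  exact ae_restrict_of_ae_restrict_of_subset hsub hvw

variable [MeasurableSpace Ω] {π : Eucl d → Ω}

namespace IsFlatCover

theorem map_sub (hπ : IsFlatCover π) (x y : Eucl d) : π (x - y) = π x - π y := by
  rw [eq_sub_iff_add_eq, ← hπ.map_add, sub_add_cancel]

theorem map_zero (hπ : IsFlatCover π) : π 0 = 0 := by
  simpa using hπ.map_sub 0 0

theorem norm_le (hπ : IsFlatCover π) (x : Eucl d) : ‖π x‖ ≤ ‖x‖ := by
  have := hπ.lipschitz.dist_le_mul x 0
  simpa [hπ.map_zero] using this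

theorem surjective (hπ : IsFlatCover π) : Function.Surjective π := fun x =>
  ⟨hπ.exists_section.choose x, hπ.exists_section.choose_spec.2.1 x⟩

/-- The derivative of a curve, as a jointly measurable limit of difference quotients. -/
noncomputable def curveDeriv (hπ : IsFlatCover π) (hT : 0 ≤ T) (γ : Curve Ω T) (t : ℝ) : Eucl d :=
  limUnder atTop fun n : ℕ => (n : ℝ) •
    hπ.exists_section.choose (evalAt hT γ (t + (n : ℝ)⁻¹) - evalAt hT γ t)

/-- The velocity chosen in `velocity` carries no measurability in the curve; joint measurability in
curve and time is what Fubini requires later. -/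
theorem stronglyMeasurable_curveDeriv [BorelSpace Ω] [SecondCountableTopology Ω]
    (hπ : IsFlatCover π) (hT : 0 ≤ T) :
    StronglyMeasurable fun p : Curve Ω T × ℝ => hπ.curveDeriv hT p.1 p.2 := by
  refine StronglyMeasurable.limUnder fun n => ?_
  have h1 : Continuous fun p : Curve Ω T × ℝ =>
      evalAt hT p.1 (p.2 + (n : ℝ)⁻¹) - evalAt hT p.1 p.2 := by
    refine Continuous.sub ?_ (continuous_evalAt hT)
    exact (continuous_evalAt hT).comp (f := fun p : Curve Ω T × ℝ => (p.1, p.2 + (n : ℝ)⁻¹))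
      (by fun_prop)
  have h2 := (hπ.exists_section.choose_spec.1.comp h1.measurable).const_smul (n : ℝ)
  exact h2.stronglyMeasurable

/-- For large `n` the increment of the lift over time `1/n` is shorter than `r`, so the section
recovers it from its projection, and Lebesgue differentiation identifies the limit. In particular
the velocity is unique up to a null set. -/
theorem ae_eq_curveDeriv (hπ : IsFlatCover π) (hT : 0 < T) {γ : Curve Ω T} {v : ℝ → Eucl d}
    (h : HasL2Velocity π γ v) : v =ᵐ[volume.restrict (Icc 0 T)] hπ.curveDeriv hT.le γ := by
  obtain ⟨x₀, hx⟩ := h.2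
  obtain ⟨-, -, r, hr, hsr⟩ := hπ.exists_section.choose_spec
  filter_upwards [ae_mem_Ioo_hasDerivAt_integral hT (h.1.integrable (by norm_num))] with t ht
  have hn : Tendsto (fun n : ℕ => (n : ℝ)⁻¹) atTop (𝓝[>] 0) :=
    tendsto_inv_atTop_nhdsGT_zero.comp tendsto_natCast_atTop_atTop
  have h1 := ht.2.tendsto_slope_zero_right.comp hn
  have hn0 : Tendsto (fun n : ℕ => t + (n : ℝ)⁻¹) atTop (𝓝 t) := by
    simpa using (hn.mono_right nhdsWithin_le_nhds).const_add t
  have e1 : ∀ᶠ n : ℕ in atTop, t + (n : ℝ)⁻¹ < T := hn0.eventually_lt_const ht.1.2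
  have e2 : ∀ᶠ n : ℕ in atTop, ‖(∫ y in (0 : ℝ)..(t + (n : ℝ)⁻¹), v y) -
      ∫ y in (0 : ℝ)..t, v y‖ < r := by
    have := ((ht.2.continuousAt.tendsto.comp hn0).sub_const (∫ y in (0 : ℝ)..t, v y)).norm
    rw [sub_self, norm_zero] at this
    exact this.eventually_lt_const hr
  symm
  apply Tendsto.limUnder_eq
  refine h1.congr' ?_
  filter_upwards [e1, e2] with n hn1 hn2
  have hn3 : 0 ≤ (n : ℝ)⁻¹ := by positivity
  have m1 : t + (n : ℝ)⁻¹ ∈ Icc 0 T := ⟨by linarith [ht.1.1], hn1.le⟩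
  have m2 : t ∈ Icc 0 T := ⟨ht.1.1.le, ht.1.2.le⟩
  simp only [Function.comp_apply, inv_inv]
  congr 1
  rw [evalAt, evalAt, projIcc_of_mem hT.le m1, projIcc_of_mem hT.le m2, hx, hx, ← hπ.map_sub,
    add_sub_add_left_eq_sub]
  exact (hsr _ hn2).symm

theorem hasL2Velocity_curveDeriv (hπ : IsFlatCover π) (hT : 0 < T) {γ : Curve Ω T}
    (h : IsH1 π γ) : HasL2Velocity π γ (hπ.curveDeriv hT.le γ) := by
  obtain ⟨v, hv⟩ := h
  exact hv.congr (hπ.ae_eq_curveDeriv hT hv)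

theorem hasL2Velocity_add (hπ : IsFlatCover π) {γ ω : Curve Ω T} {v w : ℝ → Eucl d}
    (h : HasL2Velocity π γ v) (h' : HasL2Velocity π ω w) : HasL2Velocity π (γ + ω) (v + w) := by
  obtain ⟨x₀, hx⟩ := h.2
  obtain ⟨y₀, hy⟩ := h'.2
  refine ⟨h.1.add h'.1, x₀ + y₀, fun t => ?_⟩
  have h0 : (0 : ℝ) ∈ Icc 0 T := ⟨le_rfl, t.2.1.trans t.2.2⟩
  simp only [Pi.add_apply]
  rw [ContinuousMap.add_apply, hx, hy, ← hπ.map_add, intervalIntegral.integral_add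
    (h.intervalIntegrable h0 t.2) (h'.intervalIntegrable h0 t.2)]
  congr 1
  abel

theorem hasL2Velocity_sub (hπ : IsFlatCover π) {γ ω : Curve Ω T} {v w : ℝ → Eucl d}
    (h : HasL2Velocity π γ v) (h' : HasL2Velocity π ω w) : HasL2Velocity π (γ - ω) (v - w) := by
  obtain ⟨x₀, hx⟩ := h.2
  obtain ⟨y₀, hy⟩ := h'.2
  refine ⟨h.1.sub h'.1, x₀ - y₀, fun t => ?_⟩
  have h0 : (0 : ℝ) ∈ Icc 0 T := ⟨le_rfl, t.2.1.trans t.2.2⟩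
  simp only [Pi.sub_apply]
  rw [ContinuousMap.sub_apply, hx, hy, ← hπ.map_sub, intervalIntegral.integral_sub
    (h.intervalIntegrable h0 t.2) (h'.intervalIntegrable h0 t.2)]
  congr 1
  abel

theorem hasL2Velocity_const (hπ : IsFlatCover π) (x : Ω) :
    HasL2Velocity π (ContinuousMap.const _ x : Curve Ω T) 0 := by
  obtain ⟨y, rfl⟩ := hπ.surjective x
  exact ⟨MemLp.zero, y, fun t => by simp⟩

theorem weightedEnergy_eq (hπ : IsFlatCover π) (hT : 0 < T) {γ : Curve Ω T} {v : ℝ → Eucl d}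
    (h : HasL2Velocity π γ v) (w : Ω → ℝ) :
    weightedEnergy π w γ = ∫⁻ t in Icc 0 T,
      ENNReal.ofReal (1 / 2 * ‖v t‖ ^ 2 * w (evalAt hT.le γ t)) := by
  have hH : IsH1 π γ := ⟨v, h⟩
  have hvel : HasL2Velocity π γ (velocity π γ) := by
    rw [velocity, dif_pos hH]; exact hH.choose_spec
  have hae := (hπ.ae_eq_curveDeriv hT hvel).trans (hπ.ae_eq_curveDeriv hT h).symm
  rw [weightedEnergy, if_pos hH]
  calc _ = ∫⁻ t : ↥(Icc (0 : ℝ) T), (fun t : ℝ =>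
        ENNReal.ofReal (1 / 2 * ‖velocity π γ t‖ ^ 2 * w (evalAt hT.le γ t))) t
          ∂(volume.comap Subtype.val) := by
        refine lintegral_congr fun t => ?_
        simp only [evalAt, projIcc_val]
    _ = ∫⁻ t in Icc 0 T,
        ENNReal.ofReal (1 / 2 * ‖velocity π γ t‖ ^ 2 * w (evalAt hT.le γ t)) :=
        lintegral_subtype_comap (s := Icc (0 : ℝ) T) measurableSet_Icc
          fun t => ENNReal.ofReal (1 / 2 * ‖velocity π γ t‖ ^ 2 * w (evalAt hT.le γ t))
    _ = _ := by
        apply lintegral_congr_ae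
        filter_upwards [hae] with t ht
        rw [ht]

theorem dist_le (hπ : IsFlatCover π) {γ : Curve Ω T} {v : ℝ → Eucl d}
    (h : HasL2Velocity π γ v) (s t : Icc (0 : ℝ) T) :
    dist (γ s) (γ t) ≤ ‖∫ y in (t : ℝ)..s, v y‖ := by
  obtain ⟨x₀, hx⟩ := h.2
  have h0 : (0 : ℝ) ∈ Icc 0 T := ⟨le_rfl, t.2.1.trans t.2.2⟩
  rw [dist_eq_norm, hx, hx, ← hπ.map_sub, add_sub_add_left_eq_sub,
    intervalIntegral.integral_interval_sub_left (h.intervalIntegrable h0 s.2)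
    (h.intervalIntegrable h0 t.2)]
  exact hπ.norm_le _

theorem dist_evalAt_le (hπ : IsFlatCover π) (hT : 0 < T) {γ : Curve Ω T} {v : ℝ → Eucl d}
    (h : HasL2Velocity π γ v) {B : ℝ} (hB : ∀ᵐ t ∂volume.restrict (Icc 0 T), ‖v t‖ ≤ B)
    {s t : ℝ} (hs : s ∈ Icc 0 T) (ht : t ∈ Icc 0 T) :
    dist (evalAt hT.le γ s) (evalAt hT.le γ t) ≤ B * |s - t| := by
  rw [evalAt, evalAt, projIcc_of_mem hT.le hs, projIcc_of_mem hT.le ht]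
  refine (hπ.dist_le h _ _).trans ?_
  apply intervalIntegral.norm_integral_le_of_norm_le_const_ae
  have := (ae_restrict_iff' measurableSet_Icc).1 hB
  filter_upwards [this] with y hy hyI
  exact hy (uIcc_subset_Icc ht hs (uIoc_subset_uIcc hyI))

end IsFlatCover

theorem HasL2Velocity.isC11With {Ω : Type} [NormedAddCommGroup Ω] {T : ℝ} {π : Eucl d → Ω}
    {γ : Curve Ω T} {v g : ℝ → Eucl d}
    (h : HasL2Velocity π γ v) (hvg : v =ᵐ[volume.restrict (Icc 0 T)] g) {L : ℝ≥0}
    (hg : LipschitzWith L g) : IsC11With π L γ := by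
  obtain ⟨x₀, hx⟩ := (h.congr hvg).2
  refine ⟨fun t => x₀ + ∫ s in (0 : ℝ)..t, g s, g, hx, fun t _ => ?_, hg.lipschitzOnWith⟩
  apply HasDerivAt.hasDerivWithinAt
  apply HasDerivAt.const_add
  exact hg.continuous.integral_hasStrictDerivAt 0 t |>.hasDerivAt

end Cover

/-! ### Energy bounds by comparison with constant curves -/

section Energy

variable {d : ℕ} {Ω : Type} [NormedAddCommGroup Ω] {π : Eucl d → Ω}

theorem isH1_of_weightedEnergy_ne_top {T : ℝ} {w : Ω → ℝ} {γ : Curve Ω T}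
    (h : weightedEnergy π w γ ≠ ⊤) : IsH1 π γ := by
  by_contra hn
  exact h (by rw [weightedEnergy, if_neg hn])

theorem HasL2Velocity.integrable_sq {T : ℝ} {γ : Curve Ω T} {v : ℝ → Eucl d}
    (h : HasL2Velocity π γ v) :
    Integrable (fun t => ‖v t‖ ^ 2) (volume.restrict (Icc 0 T)) :=
  (memLp_two_iff_integrable_sq_norm h.1.1).1 h.1

variable [MeasurableSpace Ω]

theorem IsFlatCover.kineticEnergy_eq (hπ : IsFlatCover π) {T : ℝ} (hT : 0 < T) {γ : Curve Ω T}
    {v : ℝ → Eucl d} (h : HasL2Velocity π γ v) :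
    kineticEnergy π γ = ENNReal.ofReal (∫ t in Icc 0 T, 1 / 2 * ‖v t‖ ^ 2) := by
  rw [kineticEnergy, hπ.weightedEnergy_eq hT h, ofReal_integral_eq_lintegral_ofReal]
  · simp
  · exact h.integrable_sq.const_mul _
  · exact ae_of_all _ fun t => by positivity

theorem IsFlatCover.interaction_const_le (hπ : IsFlatCover π) {T : ℝ} (hT : 0 < T) {η : Ω → ℝ}
    {H : ℝ} (hH : 0 < H) (hη : ∀ y, η y ≤ H) (x : Ω) (ω : Curve Ω T) :
    interaction π η (ContinuousMap.const _ x) ω ≤ ENNReal.ofReal H * kineticEnergy π ω := by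
  by_cases h : IsH1 π ω
  · obtain ⟨v, hv⟩ := h
    rw [interaction, kineticEnergy, hπ.weightedEnergy_eq hT hv,
      hπ.weightedEnergy_eq hT (hπ.hasL2Velocity_sub (hπ.hasL2Velocity_const x) hv),
      ← lintegral_const_mul' _ _ ENNReal.ofReal_ne_top]
    refine lintegral_mono fun t => ?_
    rw [← ENNReal.ofReal_mul hH.le]
    apply ENNReal.ofReal_le_ofReal
    simp only [zero_sub, Pi.neg_apply, norm_neg]
    have := mul_le_mul_of_nonneg_left (hη (evalAt hT.le (ContinuousMap.const _ x - ω) t))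
      (by positivity : 0 ≤ 1 / 2 * ‖v t‖ ^ 2)
    linarith
  -- Strict positivity of `H` matters here: the product of `0` and `⊤` would be `0`.
  · rw [kineticEnergy, weightedEnergy, if_neg h, ENNReal.mul_top]
    · exact le_top
    · simpa using hH

namespace MFG

variable {G : MFG Ω} {Q : Measure (Curve Ω G.T)}

theorem F_eq_coe {γ : Curve Ω G.T} {k v : ℝ} (hk0 : 0 ≤ k) (hv0 : 0 ≤ v)
    (hk : kineticEnergy π γ = ENNReal.ofReal k) (hv : G.VQ π Q γ = ENNReal.ofReal v) :
    G.F π Q γ = ((G.δ * k + G.Ψ (γ ⟨G.T, right_mem_Icc.2 G.T_pos.le⟩) + G.lam * v : ℝ) : EReal) := by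
  have h1 := G.δ_pos.le
  have h2 := G.lam_pos.le
  rw [F, hk, hv, ← ENNReal.ofReal_mul h1, ← ENNReal.ofReal_mul h2, EReal.coe_ennreal_ofReal,
    EReal.coe_ennreal_ofReal, max_eq_left (by positivity), max_eq_left (by positivity)]
  norm_cast

theorem ne_top_of_F_ne_top {γ : Curve Ω G.T} (h : G.F π Q γ ≠ ⊤) :
    kineticEnergy π γ ≠ ⊤ ∧ G.VQ π Q γ ≠ ⊤ := by
  have h1 : ENNReal.ofReal G.δ ≠ 0 := by simpa using G.δ_pos
  have h2 : ENNReal.ofReal G.lam ≠ 0 := by simpa using G.lam_pos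
  constructor
  · intro hk
    apply h
    rw [F, hk, ENNReal.mul_top h1, EReal.coe_ennreal_top, EReal.top_add_coe,
      EReal.top_add_of_ne_bot]
    exact EReal.coe_ennreal_ne_bot _
  · intro hv
    apply h
    rw [F, hv, ENNReal.mul_top h2, EReal.coe_ennreal_top, EReal.add_top_of_ne_bot]
    rw [ne_eq, EReal.add_eq_bot_iff, not_or]
    exact ⟨EReal.coe_ennreal_ne_bot _, EReal.coe_ne_bot _⟩

theorem IsEquilibrium.le (hQ : G.IsEquilibrium π Q) {γ ω : Curve Ω G.T} (hγ : γ ∈ Q.support)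
    (h : G.start ω = G.start γ) : G.F π Q γ ≤ G.F π Q ω := by
  rw [hQ.optimal γ hγ]
  exact iInf₂_le ω h

/-- Young's inequality for the variation of the final cost along a curve. -/
theorem abs_final_cost_sub_le (hπ : IsFlatCover π) {K : ℝ≥0} (hK : LipschitzWith K G.Ψ)
    {γ : Curve Ω G.T} {v : ℝ → Eucl d} (h : HasL2Velocity π γ v) :
    |G.Ψ (γ ⟨G.T, right_mem_Icc.2 G.T_pos.le⟩) - G.Ψ (G.start γ)| ≤
      G.δ / 2 * (∫ t in Icc 0 G.T, 1 / 2 * ‖v t‖ ^ 2) + G.T * (K ^ 2 / G.δ) := by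
  have hδ := G.δ_pos
  have hT := G.T_pos
  have h1 := hK.dist_le_mul (γ ⟨G.T, right_mem_Icc.2 G.T_pos.le⟩) (G.start γ)
  have h2 := hπ.dist_le h ⟨G.T, right_mem_Icc.2 G.T_pos.le⟩ ⟨0, left_mem_Icc.2 G.T_pos.le⟩
  have hv : Integrable v (volume.restrict (Icc 0 G.T)) := h.1.integrable (by norm_num)
  rw [Real.dist_eq] at h1
  calc _ ≤ _ := h1
    _ ≤ K * ∫ t in Icc 0 G.T, ‖v t‖ := by
      gcongr
      refine h2.trans ?_
      simp only
      rw [intervalIntegral.integral_of_le hT.le, ← integral_Icc_eq_integral_Ioc]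
      exact norm_integral_le_integral_norm _
    _ = ∫ t in Icc 0 G.T, K * ‖v t‖ := by rw [integral_const_mul]
    -- The weights in Young's inequality spend only half of `δK(γ)`, leaving the other half to be
    -- controlled.
    _ ≤ ∫ t in Icc 0 G.T, (G.δ / 2 * (1 / 2 * ‖v t‖ ^ 2) + K ^ 2 / G.δ) := by
      apply integral_mono (hv.norm.const_mul _)
      · exact ((h.integrable_sq.const_mul _).const_mul _).add (integrable_const _)
      · intro t
        have h3 : G.δ / 2 * (1 / 2 * ‖v t‖ ^ 2) + K ^ 2 / G.δ - K * ‖v t‖ =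
            (G.δ * ‖v t‖ / 2 - K) ^ 2 / G.δ := by field_simp; ring
        have : 0 ≤ (G.δ * ‖v t‖ / 2 - K) ^ 2 / G.δ := by positivity
        simp only
        linarith
    _ = _ := by
      rw [integral_add ((h.integrable_sq.const_mul _).const_mul _) (integrable_const _),
        integral_const_mul, setIntegral_const, Real.volume_real_Icc, sub_zero,
        max_eq_left hT.le, smul_eq_mul]

/-- The final cost is at least `Ψ(γ(0))` minus half the kinetic term and a constant. Only the
initial point remains, whose law under an equilibrium is `m₀`; this is why integrability of the
negative part of `Ψ` suffices. -/
theorem kineticEnergy_le (hπ : IsFlatCover π) {K : ℝ≥0} (hK : LipschitzWith K G.Ψ)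
    (γ : Curve Ω G.T) :
    ENNReal.ofReal (G.δ / 2) * kineticEnergy π γ ≤ (G.F π Q γ).toENNReal +
      ENNReal.ofReal (G.T * (K ^ 2 / G.δ)) + ENNReal.ofReal (-G.Ψ (G.start γ)) := by
  by_cases hF : G.F π Q γ = ⊤
  · simp [hF]
  obtain ⟨h1, h2⟩ := ne_top_of_F_ne_top hF
  obtain ⟨v, hv⟩ := isH1_of_weightedEnergy_ne_top h1
  have hk := hπ.kineticEnergy_eq G.T_pos hv
  have hk0 : 0 ≤ ∫ t in Icc 0 G.T, 1 / 2 * ‖v t‖ ^ 2 := integral_nonneg fun t => by positivity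
  rw [F_eq_coe hk0 ENNReal.toReal_nonneg hk (ENNReal.ofReal_toReal h2).symm,
    EReal.toENNReal_of_ne_top (EReal.coe_ne_top _), EReal.toReal_coe, hk,
    ← ENNReal.ofReal_mul (by have := G.δ_pos; positivity)]
  refine (ENNReal.ofReal_le_ofReal ?_).trans
    (ENNReal.ofReal_add_le.trans (add_le_add ENNReal.ofReal_add_le le_rfl))
  have h3 := (abs_le.1 (abs_final_cost_sub_le hπ hK hv)).1
  have h4 : 0 ≤ G.lam * (G.VQ π Q γ).toReal := mul_nonneg G.lam_pos.le ENNReal.toReal_nonneg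
  linarith

theorem IsEquilibrium.lintegral_kineticEnergy_lt_top [BorelSpace Ω] (hπ : IsFlatCover π)
    (hΨ : G.FinalCostCondition) (hQ : G.IsEquilibrium π Q)
    (h : ∫⁻ x, ENNReal.ofReal (-G.Ψ x) ∂G.m₀ < ⊤) : ∫⁻ γ, kineticEnergy π γ ∂Q < ⊤ := by
  obtain ⟨K, hK⟩ := hΨ
  have := hQ.isProb
  have hst : Measurable G.start := by
    refine Continuous.measurable ?_
    unfold start
    fun_prop
  have hm : Measurable fun x => ENNReal.ofReal (-G.Ψ x) :=
    (G.Ψ_continuous.neg).measurable.ennreal_ofReal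
  have h1 : ENNReal.ofReal (G.δ / 2) * ∫⁻ γ, kineticEnergy π γ ∂Q < ⊤ := by
    rw [← lintegral_const_mul' _ _ ENNReal.ofReal_ne_top]
    refine (lintegral_mono fun γ => kineticEnergy_le (Q := Q) hπ hK γ).trans_lt ?_
    have hm' : Measurable fun γ => ENNReal.ofReal (-G.Ψ (G.start γ)) := hm.comp hst
    rw [lintegral_add_right _ hm', lintegral_add_right _ measurable_const,
      lintegral_const, measure_univ, mul_one]
    have h2 : ∫⁻ γ, ENNReal.ofReal (-G.Ψ (G.start γ)) ∂Q =
        ∫⁻ x, ENNReal.ofReal (-G.Ψ x) ∂G.m₀ := by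
      rw [← hQ.initial, lintegral_map hm hst]
    exact ENNReal.add_lt_top.2 ⟨ENNReal.add_lt_top.2 ⟨hQ.finite_cost, ENNReal.ofReal_lt_top⟩, h2 ▸ h⟩
  by_contra hn
  rw [not_lt, top_le_iff] at hn
  rw [hn, ENNReal.mul_top] at h1
  · exact lt_irrefl _ h1
  · simpa using G.δ_pos

/-- Comparison with constant curves. -/
theorem IsEquilibrium.exists_energy_bound (hπ : IsFlatCover π)
    (hΨ : G.FinalCostCondition) (hQ : G.IsEquilibrium π Q)
    (h : ∫⁻ γ, kineticEnergy π γ ∂Q < ⊤) :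
    ∃ M : ℝ≥0, ∀ γ ∈ Q.support, IsH1 π γ ∧ kineticEnergy π γ ≤ M ∧ G.VQ π Q γ ≤ M := by
  obtain ⟨K, hK⟩ := hΨ
  obtain ⟨H', hH'⟩ := G.η_bounded
  have hδ := G.δ_pos
  have hlam := G.lam_pos
  set H := |H'| + 1 with hHdef
  have hH : 0 < H := by positivity
  have hHb : ∀ y, G.η y ≤ H := fun y => (hH' y).trans ((le_abs_self _).trans (by linarith))
  set I := ∫⁻ γ, kineticEnergy π γ ∂Q with hI
  set C₀ := G.T * (K ^ 2 / G.δ) with hC₀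
  have hC₀0 : 0 ≤ C₀ := mul_nonneg G.T_pos.le (by positivity)
  set A := G.lam * (H * I.toReal) + C₀ with hA
  have hA0 : 0 ≤ A := by positivity
  -- Comparison will give `(δ/2)K(γ) + λV_Q(γ) ≤ A`, where `Ψ(γ(0))` has cancelled. Both terms are
  -- nonnegative, and the sum of the two bounds serves for each.
  refine ⟨(2 * A / G.δ + A / G.lam).toNNReal, fun γ hγ => ?_⟩
  set x := G.start γ with hx
  set c : Curve Ω G.T := ContinuousMap.const _ x with hc
  have hVc : G.VQ π Q c ≤ ENNReal.ofReal (H * I.toReal) := by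
    rw [ENNReal.ofReal_mul hH.le, ENNReal.ofReal_toReal h.ne, hI,
      ← lintegral_const_mul' _ _ ENNReal.ofReal_ne_top]
    exact lintegral_mono fun ω => hπ.interaction_const_le G.T_pos hH hHb x ω
  have hVc' : G.VQ π Q c ≠ ⊤ := (hVc.trans_lt ENNReal.ofReal_lt_top).ne
  have hVcr : (G.VQ π Q c).toReal ≤ H * I.toReal :=
    ENNReal.toReal_le_of_le_ofReal (by positivity) hVc
  have hKc : kineticEnergy π c = ENNReal.ofReal 0 := by
    rw [hπ.kineticEnergy_eq G.T_pos (hπ.hasL2Velocity_const x)]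
    simp
  have hFc := F_eq_coe (Q := Q) le_rfl ENNReal.toReal_nonneg hKc (ENNReal.ofReal_toReal hVc').symm
  have hle : G.F π Q γ ≤ G.F π Q c := hQ.le hγ rfl
  have hFγ : G.F π Q γ ≠ ⊤ := by
    intro ht
    rw [ht, hFc, top_le_iff] at hle
    exact EReal.coe_ne_top _ hle
  obtain ⟨h1, h2⟩ := ne_top_of_F_ne_top hFγ
  obtain ⟨v, hv⟩ := isH1_of_weightedEnergy_ne_top h1
  have hk := hπ.kineticEnergy_eq G.T_pos hv
  set k := ∫ t in Icc 0 G.T, 1 / 2 * ‖v t‖ ^ 2 with hkdef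
  have hk0 : 0 ≤ k := integral_nonneg fun t => by positivity
  rw [hFc, F_eq_coe hk0 ENNReal.toReal_nonneg hk (ENNReal.ofReal_toReal h2).symm,
    EReal.coe_le_coe_iff] at hle
  have h3 := (abs_le.1 (abs_final_cost_sub_le hπ hK hv)).1
  have h4 : G.Ψ (c ⟨G.T, right_mem_Icc.2 G.T_pos.le⟩) = G.Ψ (G.start γ) := rfl
  rw [h4] at hle
  have h5 : 0 ≤ (G.VQ π Q γ).toReal := ENNReal.toReal_nonneg
  have h6 : G.δ / 2 * k + G.lam * (G.VQ π Q γ).toReal ≤ A := by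
    have := mul_le_mul_of_nonneg_left hVcr hlam.le
    rw [hA]
    linarith
  have h7 : k ≤ 2 * A / G.δ := by
    rw [le_div_iff₀ hδ]
    nlinarith [mul_nonneg hlam.le h5]
  have h8 : (G.VQ π Q γ).toReal ≤ A / G.lam := by
    rw [le_div_iff₀ hlam]
    nlinarith [mul_nonneg hδ.le hk0]
  have h9 : 0 ≤ 2 * A / G.δ := by positivity
  have h10 : 0 ≤ A / G.lam := by positivity
  refine ⟨⟨v, hv⟩, ?_, ?_⟩
  · rw [hk]
    exact ENNReal.ofReal_le_ofReal (by linarith)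
  · rw [← ENNReal.ofReal_toReal h2]
    exact ENNReal.ofReal_le_ofReal (by linarith)

end MFG

end Energy

/-! ### Momentum, energy density and their measurability -/

section Variation

variable {d : ℕ} {Ω : Type} [NormedAddCommGroup Ω] [MeasurableSpace Ω] {π : Eucl d → Ω}

namespace MFG

/-- The weight `η(γ(t) - ω(t))` of the interaction of two curves. -/
noncomputable def weight (G : MFG Ω) (γ ω : Curve Ω G.T) (t : ℝ) : ℝ :=
  G.η (evalAt G.T_pos.le γ t - evalAt G.T_pos.le ω t)

/-- The derivative of a curve. -/
noncomputable def vel (G : MFG Ω) (hπ : IsFlatCover π) (γ : Curve Ω G.T) (t : ℝ) : Eucl d :=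
  hπ.curveDeriv G.T_pos.le γ t

/-- The momentum `δ γ' + λ ∫ (γ' - ω') η(γ - ω) dQ(ω)`. -/
noncomputable def momentum (G : MFG Ω) (hπ : IsFlatCover π) (Q : Measure (Curve Ω G.T))
    (γ : Curve Ω G.T) (t : ℝ) : Eucl d :=
  G.δ • G.vel hπ γ t + G.lam • ∫ ω, G.weight γ ω t • (G.vel hπ γ t - G.vel hπ ω t) ∂Q

/-- The density in time of `V_Q(γ)`. -/
noncomputable def energyDensity (G : MFG Ω) (hπ : IsFlatCover π) (Q : Measure (Curve Ω G.T))
    (γ : Curve Ω G.T) (t : ℝ) : ℝ :=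
  ∫ ω, 1 / 2 * ‖G.vel hπ γ t - G.vel hπ ω t‖ ^ 2 * G.weight γ ω t ∂Q

variable {G : MFG Ω} {Q : Measure (Curve Ω G.T)}

theorem weight_nonneg (γ ω : Curve Ω G.T) (t : ℝ) : 0 ≤ G.weight γ ω t := G.η_nonneg _

theorem continuous_weight :
    Continuous fun q : (Curve Ω G.T × ℝ) × Curve Ω G.T => G.weight q.1.1 q.2 q.1.2 := by
  refine G.η_continuous.comp (Continuous.sub ?_ ?_)
  · exact (continuous_evalAt G.T_pos.le).comp continuous_fst
  · exact (continuous_evalAt G.T_pos.le).comp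
      (f := fun q : (Curve Ω G.T × ℝ) × Curve Ω G.T => (q.2, q.1.2)) (by fun_prop)

variable [SecondCountableTopology Ω]

theorem measurable_weight :
    Measurable fun q : (Curve Ω G.T × ℝ) × Curve Ω G.T => G.weight q.1.1 q.2 q.1.2 :=
  continuous_weight.measurable

theorem measurable_weight_prod (γ : Curve Ω G.T) :
    Measurable fun z : ℝ × Curve Ω G.T => G.weight γ z.2 z.1 :=
  measurable_weight.comp (f := fun z : ℝ × Curve Ω G.T => ((γ, z.1), z.2)) (by fun_prop)

theorem measurable_weight_right (γ : Curve Ω G.T) (t : ℝ) :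
    Measurable fun ω => G.weight γ ω t :=
  measurable_weight.comp (f := fun ω : Curve Ω G.T => ((γ, t), ω)) (by fun_prop)

theorem integrable_mul_weight {f : ℝ × Curve Ω G.T → ℝ} (γ : Curve Ω G.T)
    (hf : Integrable f ((volume.restrict (Icc 0 G.T)).prod Q)) :
    Integrable (fun z => f z * G.weight γ z.2 z.1) ((volume.restrict (Icc 0 G.T)).prod Q) := by
  obtain ⟨H, hH⟩ := G.η_bounded
  refine hf.mul_bdd (c := H) (measurable_weight_prod γ).aestronglyMeasurable (ae_of_all _ fun z => ?_)
  rw [Real.norm_eq_abs, abs_of_nonneg (weight_nonneg _ _ _)]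
  exact hH _

variable [BorelSpace Ω]

theorem stronglyMeasurable_vel (hπ : IsFlatCover π) :
    StronglyMeasurable fun q : Curve Ω G.T × ℝ => G.vel hπ q.1 q.2 :=
  hπ.stronglyMeasurable_curveDeriv G.T_pos.le

theorem stronglyMeasurable_vel_swap (hπ : IsFlatCover π) :
    StronglyMeasurable fun z : ℝ × Curve Ω G.T => G.vel hπ z.2 z.1 :=
  (stronglyMeasurable_vel hπ).comp_measurable
    (g := fun z : ℝ × Curve Ω G.T => (z.2, z.1)) (by fun_prop)

theorem stronglyMeasurable_vel_left (hπ : IsFlatCover π) (t : ℝ) :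
    StronglyMeasurable fun γ => G.vel hπ γ t :=
  (stronglyMeasurable_vel hπ).comp_measurable (g := fun γ : Curve Ω G.T => (γ, t)) (by fun_prop)

variable [IsProbabilityMeasure Q]

theorem memLp_vel (hπ : IsFlatCover π) {M : ℝ≥0}
    (hM : ∀ᵐ ω ∂Q, IsH1 π ω ∧ kineticEnergy π ω ≤ M) :
    MemLp (fun z : ℝ × Curve Ω G.T => G.vel hπ z.2 z.1) 2
      ((volume.restrict (Icc 0 G.T)).prod Q) := by
  have hsm := stronglyMeasurable_vel_swap (G := G) hπ
  rw [memLp_two_iff_integrable_sq_norm hsm.aestronglyMeasurable]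
  have hsm2 : StronglyMeasurable fun z : ℝ × Curve Ω G.T => ‖G.vel hπ z.2 z.1‖ ^ 2 :=
    hsm.norm.pow 2
  rw [integrable_prod_iff' hsm2.aestronglyMeasurable]
  constructor
  · filter_upwards [hM] with ω hω
    exact (hπ.hasL2Velocity_curveDeriv G.T_pos hω.1).integrable_sq
  · have hsm3 := hsm2.norm.integral_prod_left' (μ := volume.restrict (Icc 0 G.T))
    refine Integrable.of_bound hsm3.aestronglyMeasurable (2 * M) ?_
    filter_upwards [hM] with ω hω
    have h1 := hπ.hasL2Velocity_curveDeriv G.T_pos hω.1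
    have h2 := hω.2
    rw [hπ.kineticEnergy_eq G.T_pos h1] at h2
    have h3 : ∫ t in Icc 0 G.T, 1 / 2 * ‖hπ.curveDeriv G.T_pos.le ω t‖ ^ 2 ≤ (M : ℝ) := by
      simpa using (ENNReal.ofReal_le_iff_le_toReal ENNReal.coe_ne_top).1 h2
    rw [integral_const_mul] at h3
    rw [Real.norm_eq_abs, abs_of_nonneg (integral_nonneg fun _ => norm_nonneg _)]
    simp only [norm_pow, norm_norm]
    change ∫ t in Icc 0 G.T, ‖hπ.curveDeriv G.T_pos.le ω t‖ ^ 2 ≤ _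
    linarith

theorem memLp_sub_vel (hπ : IsFlatCover π) {M : ℝ≥0}
    (hM : ∀ᵐ ω ∂Q, IsH1 π ω ∧ kineticEnergy π ω ≤ M) {γ : Curve Ω G.T} {v : ℝ → Eucl d}
    (hv : HasL2Velocity π γ v) :
    MemLp (fun z : ℝ × Curve Ω G.T => v z.1 - G.vel hπ z.2 z.1) 2
      ((volume.restrict (Icc 0 G.T)).prod Q) :=
  (hv.1.comp_fst Q).sub (memLp_vel hπ hM)

/-- Tonelli on `[0,T] × Γ`. The weight is bounded and the relative velocity is square integrable on
the product, so `V_Q` is finite at every `H¹` curve, in particular at all perturbations of a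
minimizer. -/
theorem VQ_eq (hπ : IsFlatCover π) {M : ℝ≥0}
    (hM : ∀ᵐ ω ∂Q, IsH1 π ω ∧ kineticEnergy π ω ≤ M) {γ : Curve Ω G.T} {v : ℝ → Eucl d}
    (hv : HasL2Velocity π γ v) :
    Integrable (fun z : ℝ × Curve Ω G.T =>
        1 / 2 * ‖v z.1 - G.vel hπ z.2 z.1‖ ^ 2 * G.weight γ z.2 z.1)
      ((volume.restrict (Icc 0 G.T)).prod Q) ∧
    G.VQ π Q γ = ENNReal.ofReal (∫ z, 1 / 2 * ‖v z.1 - G.vel hπ z.2 z.1‖ ^ 2 * G.weight γ z.2 z.1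
      ∂((volume.restrict (Icc 0 G.T)).prod Q)) := by
  have h1 := memLp_sub_vel hπ hM hv
  have h2 := integrable_mul_weight γ
    (((memLp_two_iff_integrable_sq_norm h1.1).1 h1).const_mul (1 / 2))
  refine ⟨h2, ?_⟩
  rw [ofReal_integral_eq_lintegral_ofReal h2 (ae_of_all _ fun z =>
    mul_nonneg (by positivity) (weight_nonneg _ _ _)),
    lintegral_prod_symm _ h2.1.aemeasurable.ennreal_ofReal]
  apply lintegral_congr_ae
  filter_upwards [hM] with ω hω
  rw [interaction, hπ.weightedEnergy_eq G.T_pos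
    (hπ.hasL2Velocity_sub hv (hπ.hasL2Velocity_curveDeriv G.T_pos hω.1))]
  rfl

end MFG

end Variation

/-! ### First variation at a minimizer -/

section EulerLagrange

theorem MeasureTheory.Integrable.inner_of_bound {X E : Type*} [MeasurableSpace X] {μ : Measure X}
    [NormedAddCommGroup E] [InnerProductSpace ℝ E] {f g : X → E} (hf : Integrable f μ)
    (hg : AEStronglyMeasurable g μ) {R : ℝ} (hR : ∀ x, ‖g x‖ ≤ R) :
    Integrable (fun x => inner ℝ (f x) (g x)) μ := by
  refine (hf.norm.mul_const R).mono' (hf.1.inner hg) (ae_of_all _ fun x => ?_)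
  exact (norm_inner_le_norm _ _).trans (mul_le_mul_of_nonneg_left (hR x) (norm_nonneg _))

theorem Measurable.continuous_primitive_of_bound {E : Type*} [NormedAddCommGroup E]
    [NormedSpace ℝ E] [MeasurableSpace E] [BorelSpace E] [SecondCountableTopology E] {ψ : ℝ → E}
    (hψ : Measurable ψ) {R : ℝ} (hR : ∀ x, ‖ψ x‖ ≤ R) :
    Continuous fun t : ℝ => ∫ y in (0 : ℝ)..t, ψ y := by
  apply intervalIntegral.continuous_primitive
  intro a b
  rw [intervalIntegrable_iff]
  exact Measure.integrableOn_of_bounded measure_Ioc_lt_top.ne hψ.aestronglyMeasurable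
    (ae_of_all _ hR)

/-- First order expansion of the interaction density under a perturbation. -/
theorem half_norm_sq_mul_le_expansion {E : Type*} [NormedAddCommGroup E] [InnerProductSpace ℝ E]
    (a w : E) {k k' ε c C H M : ℝ} (hk : 0 ≤ k) (hkH : k ≤ H) (hε : 0 ≤ ε) (hε1 : ε ≤ 1)
    (hc : 0 ≤ c) (hcC : c ≤ C) (hεc : ε * c ≤ 1) (hk' : k' ≤ k * Real.exp (ε * c))
    (hw : ‖w‖ ≤ M) :
    1 / 2 * ‖a + ε • w‖ ^ 2 * k' ≤ 1 / 2 * ‖a‖ ^ 2 * k +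
      ε * (inner ℝ a w * k + 1 / 2 * ‖a‖ ^ 2 * k * c) +
      ε ^ 2 * (H * (3 + C + 2 * C ^ 2) * (1 / 2 * (‖a‖ ^ 2 + M ^ 2))) := by
  set i := inner ℝ a w with hi
  set A := ‖a‖ ^ 2 with hA
  set W := ‖w‖ ^ 2 with hW
  have hexp : Real.exp (ε * c) ≤ 1 + ε * c + (ε * c) ^ 2 := by
    have h0 : 0 ≤ ε * c := by positivity
    have := Real.abs_exp_sub_one_sub_id_le (x := ε * c) (by rw [abs_of_nonneg h0]; exact hεc)
    have := (abs_le.1 this).2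
    linarith
  have hnorm : ‖a + ε • w‖ ^ 2 = A + 2 * ε * i + ε ^ 2 * W := by
    rw [norm_add_sq_real, inner_smul_right, norm_smul, mul_pow, Real.norm_eq_abs, sq_abs]
    ring
  have hA0 : 0 ≤ A := by positivity
  have hW0 : 0 ≤ W := by positivity
  have hWM : W ≤ M ^ 2 := by rw [hW]; gcongr
  set s := 1 / 2 * (A + W) with hs
  have hs0 : 0 ≤ s := by positivity
  have his : |i| ≤ s := by
    have h1 := abs_real_inner_le_norm a w
    have h2 : ‖a‖ * ‖w‖ ≤ s := by rw [hs, hA, hW]; nlinarith [sq_nonneg (‖a‖ - ‖w‖)]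
    exact h1.trans h2
  have h1 : 1 / 2 * ‖a + ε • w‖ ^ 2 * k' ≤
      1 / 2 * ‖a + ε • w‖ ^ 2 * (k * (1 + ε * c + (ε * c) ^ 2)) := by
    gcongr
    exact hk'.trans (mul_le_mul_of_nonneg_left hexp hk)
  refine h1.trans ?_
  rw [hnorm]
  -- Exact expansion. The four terms in the remainder are at most `s` times `C`, `3`, `C²` and `C²`,
  -- which gives the factor `3 + C + 2C²`; `s` is quadratic in `‖a‖`, hence the remainder stays
  -- integrable.
  have h2 : 1 / 2 * (A + 2 * ε * i + ε ^ 2 * W) * (k * (1 + ε * c + (ε * c) ^ 2)) =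
      1 / 2 * A * k + ε * (i * k + 1 / 2 * A * k * c) + ε ^ 2 * (k *
        (i * c + 1 / 2 * W * (1 + ε * c + (ε * c) ^ 2) + 1 / 2 * A * c ^ 2 + i * (ε * c ^ 2))) := by
    ring
  rw [h2]
  have hC : 0 ≤ C := hc.trans hcC
  have t1 : i * c ≤ s * C := by
    calc i * c ≤ |i| * c := by gcongr; exact le_abs_self i
      _ ≤ s * C := by gcongr
  have t2 : 1 / 2 * W * (1 + ε * c + (ε * c) ^ 2) ≤ s * 3 := by
    have : 0 ≤ ε * c := by positivity
    have : 1 / 2 * W ≤ s := by rw [hs]; linarith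
    gcongr
    nlinarith
  have t3 : 1 / 2 * A * c ^ 2 ≤ s * C ^ 2 := by
    have : 1 / 2 * A ≤ s := by rw [hs]; linarith
    gcongr
  have t4 : i * (ε * c ^ 2) ≤ s * C ^ 2 := by
    calc i * (ε * c ^ 2) ≤ |i| * (ε * c ^ 2) := by gcongr; exact le_abs_self i
      _ ≤ s * (1 * C ^ 2) := by gcongr
      _ = _ := by ring
  have hH : 0 ≤ H := hk.trans hkH
  have t5 : k * (i * c + 1 / 2 * W * (1 + ε * c + (ε * c) ^ 2) + 1 / 2 * A * c ^ 2 +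
      i * (ε * c ^ 2)) ≤ H * (3 + C + 2 * C ^ 2) * (1 / 2 * (A + M ^ 2)) := by
    calc _ ≤ k * (s * C + s * 3 + s * C ^ 2 + s * C ^ 2) := by gcongr
      _ ≤ H * (s * C + s * 3 + s * C ^ 2 + s * C ^ 2) := by gcongr
      _ = H * (3 + C + 2 * C ^ 2) * s := by ring
      _ ≤ _ := by rw [hs]; gcongr
  gcongr

theorem nonneg_of_forall_small {A B ε₀ : ℝ} (hε₀ : 0 < ε₀)
    (h : ∀ ε, 0 < ε → ε ≤ ε₀ → 0 ≤ ε * A + ε ^ 2 * B) : 0 ≤ A := by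
  by_contra hA
  push Not at hA
  have hB : 0 < |B| + 1 := by positivity
  set ε := min ε₀ (-A / (2 * (|B| + 1))) with hε
  have hε0 : 0 < ε := lt_min hε₀ (by have : 0 < -A := by linarith
                                     positivity)
  have h1 := h ε hε0 (min_le_left _ _)
  have h2 : ε * (2 * (|B| + 1)) ≤ -A := by
    rw [← le_div_iff₀ (by positivity)]; exact min_le_right _ _
  have h3 : ε * B ≤ ε * (|B| + 1) := by
    gcongr
    linarith [le_abs_self B]
  nlinarith

open MFG

variable {d : ℕ} {Ω : Type} [NormedAddCommGroup Ω] [MeasurableSpace Ω] {π : Eucl d → Ω}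

theorem IsFlatCover.exists_curve (hπ : IsFlatCover π) {T : ℝ} {ψ : ℝ → Eucl d}
    (hψ : Measurable ψ) {M : ℝ} (hM : ∀ x, ‖ψ x‖ ≤ M) :
    ∃ Φ : Curve Ω T, HasL2Velocity π Φ ψ ∧ ∀ t, Φ t = π (∫ y in (0 : ℝ)..t, ψ y) := by
  have hc := hψ.continuous_primitive_of_bound hM
  refine ⟨⟨fun t => π (∫ y in (0 : ℝ)..t, ψ y),
    hπ.lipschitz.continuous.comp (hc.comp continuous_subtype_val)⟩, ⟨?_, 0, ?_⟩, fun t => rfl⟩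
  · exact MemLp.of_bound hψ.aestronglyMeasurable M (ae_of_all _ hM)
  · intro t
    simp

variable [BorelSpace Ω] [SecondCountableTopology Ω] {G : MFG Ω} {Q : Measure (Curve Ω G.T)}

namespace MFG

/-- The first variation of `F(·,Q)` at a minimizer is nonnegative, up to the Lipschitz bounds
on `Ψ` and on `log η`. -/
theorem first_variation_nonneg [IsProbabilityMeasure Q] (hπ : IsFlatCover π) {C : ℝ} (hC0 : 0 ≤ C)
    (hC : ∀ x z, G.η (x + π z) ≤ G.η x * Real.exp (C * ‖z‖)) {K : ℝ≥0}
    (hK : LipschitzWith K G.Ψ) {M : ℝ≥0}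
    (hM : ∀ᵐ ω ∂Q, IsH1 π ω ∧ kineticEnergy π ω ≤ M) {γ : Curve Ω G.T} (hγ : IsH1 π γ)
    (hmin : ∀ ω, G.start ω = G.start γ → G.F π Q γ ≤ G.F π Q ω)
    {ψ : ℝ → Eucl d} (hψ : Measurable ψ) {R : ℝ} (hR : ∀ x, ‖ψ x‖ ≤ R) :
    0 ≤ G.δ * (∫ t in Icc 0 G.T, inner ℝ (G.vel hπ γ t) (ψ t)) +
      K * ‖∫ y in (0 : ℝ)..G.T, ψ y‖ +
      G.lam * ∫ z, (inner ℝ (G.vel hπ γ z.1 - G.vel hπ z.2 z.1) (ψ z.1) * G.weight γ z.2 z.1 +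
        1 / 2 * ‖G.vel hπ γ z.1 - G.vel hπ z.2 z.1‖ ^ 2 * G.weight γ z.2 z.1 *
          (C * ‖∫ y in (0 : ℝ)..z.1, ψ y‖)) ∂((volume.restrict (Icc 0 G.T)).prod Q) := by
  obtain ⟨H, hH⟩ := G.η_bounded
  have hT := G.T_pos
  have hR0 : 0 ≤ R := (norm_nonneg _).trans (hR 0)
  have hu := hπ.hasL2Velocity_curveDeriv hT hγ
  change HasL2Velocity π γ (G.vel hπ γ) at hu
  set u := G.vel hπ γ with hudef
  set ν := volume.restrict (Icc 0 G.T) with hν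
  set φ : ℝ → Eucl d := fun t => ∫ y in (0 : ℝ)..t, ψ y with hφ
  have hφR : ∀ t ∈ Icc 0 G.T, ‖φ t‖ ≤ R * G.T := by
    intro t ht
    refine (intervalIntegral.norm_integral_le_of_norm_le_const fun x _ => hR x).trans ?_
    rw [sub_zero, abs_of_nonneg ht.1]
    gcongr
    exact ht.2
  set C₁ := C * (R * G.T) with hC₁
  have hC₁0 : 0 ≤ C₁ := by positivity
  have hφm : AEStronglyMeasurable φ ν := (hψ.continuous_primitive_of_bound hR).aestronglyMeasurable
  obtain ⟨hV0i, hV0⟩ := VQ_eq hπ hM hu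
  have ha := memLp_sub_vel hπ hM hu
  have ha2 := (memLp_two_iff_integrable_sq_norm ha.1).1 ha
  have hψL : MemLp ψ 2 ν := MemLp.of_bound hψ.aestronglyMeasurable R (ae_of_all _ hR)
  have hψi : Integrable (fun t => ‖ψ t‖ ^ 2) ν :=
    (memLp_two_iff_integrable_sq_norm hψL.1).1 hψL
  have huψ : Integrable (fun t => inner ℝ (u t) (ψ t)) ν :=
    (hu.1.integrable (by norm_num)).inner_of_bound hψL.1 hR
  have hI1 : Integrable (fun z : ℝ × Curve Ω G.T =>
      inner ℝ (u z.1 - G.vel hπ z.2 z.1) (ψ z.1) * G.weight γ z.2 z.1) (ν.prod Q) :=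
    integrable_mul_weight γ ((ha.integrable (by norm_num)).inner_of_bound
      (hψL.comp_fst Q).1 fun z => hR z.1)
  have hI2 : Integrable (fun z : ℝ × Curve Ω G.T =>
      1 / 2 * ‖u z.1 - G.vel hπ z.2 z.1‖ ^ 2 * G.weight γ z.2 z.1 * (C * ‖φ z.1‖))
      (ν.prod Q) := by
    refine hV0i.mul_bdd (c := C₁) ?_ ?_
    · exact (hφm.norm.const_mul C).comp_fst
    · have hmem : ∀ᵐ t ∂ν, t ∈ Icc 0 G.T := ae_restrict_mem measurableSet_Icc
      filter_upwards [Measure.quasiMeasurePreserving_fst.ae hmem] with z hz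
      rw [Real.norm_eq_abs, abs_of_nonneg (by positivity)]
      exact mul_le_mul_of_nonneg_left (hφR _ hz) hC0
  have hI3 : Integrable (fun z : ℝ × Curve Ω G.T => H * (3 + C₁ + 2 * C₁ ^ 2) *
      (1 / 2 * (‖u z.1 - G.vel hπ z.2 z.1‖ ^ 2 + R ^ 2))) (ν.prod Q) :=
    ((ha2.add (integrable_const _)).const_mul _).const_mul _
  set V₁ := ∫ z : ℝ × Curve Ω G.T, (inner ℝ (u z.1 - G.vel hπ z.2 z.1) (ψ z.1) *
    G.weight γ z.2 z.1 + 1 / 2 * ‖u z.1 - G.vel hπ z.2 z.1‖ ^ 2 * G.weight γ z.2 z.1 *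
      (C * ‖φ z.1‖)) ∂(ν.prod Q) with hV₁
  set B := ∫ z : ℝ × Curve Ω G.T, H * (3 + C₁ + 2 * C₁ ^ 2) *
      (1 / 2 * (‖u z.1 - G.vel hπ z.2 z.1‖ ^ 2 + R ^ 2)) ∂(ν.prod Q) with hB
  -- This threshold ensures both `ε ≤ 1` and `εC₁ ≤ 1`, as the expansion demands.
  refine nonneg_of_forall_small (ε₀ := 1 / (1 + C₁))
    (B := G.δ * (∫ t, 1 / 2 * ‖ψ t‖ ^ 2 ∂ν) + G.lam * B) (by positivity) fun ε hε hεε => ?_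
  have hε1 : ε ≤ 1 := hεε.trans (by rw [div_le_one (by positivity)]; linarith)
  have hεC : ε * C₁ ≤ 1 := by
    rw [le_div_iff₀ (by positivity)] at hεε
    linarith
  -- The competitor is `γ + Φ`, where `Φ` projects `εφ` and vanishes at time `0`. Adding in the
  -- group `Ω` avoids lifting `γ`.
  obtain ⟨Φ, hΦ, hΦe⟩ := hπ.exists_curve (T := G.T) (ψ := fun t => ε • ψ t) (hψ.const_smul ε)
    (M := ε * R) (fun x => by rw [norm_smul, Real.norm_eq_abs, abs_of_pos hε]; gcongr; exact hR x)
  have hΦe' : ∀ t, Φ t = π (ε • φ t) := fun t => by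
    rw [hΦe, intervalIntegral.integral_smul]
  have hw := hπ.hasL2Velocity_add hu hΦ
  set w : ℝ → Eucl d := u + fun t => ε • ψ t with hwdef
  have hstart : G.start (γ + Φ) = G.start γ := by
    have : Φ ⟨0, left_mem_Icc.2 G.T_pos.le⟩ = 0 := by
      rw [hΦe]; simp [hπ.map_zero]
    simp [start, this]
  have hle := hmin (γ + Φ) hstart
  obtain ⟨hV1i, hV1⟩ := VQ_eq hπ hM hw
  have nn : ∀ (v : ℝ → Eucl d) (ω : Curve Ω G.T), 0 ≤ ∫ z : ℝ × Curve Ω G.T,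
      1 / 2 * ‖v z.1 - G.vel hπ z.2 z.1‖ ^ 2 * G.weight ω z.2 z.1 ∂(ν.prod Q) := fun v ω =>
    integral_nonneg fun z => mul_nonneg (by positivity) (weight_nonneg _ _ _)
  have nk : ∀ v : ℝ → Eucl d, 0 ≤ ∫ t in Icc 0 G.T, 1 / 2 * ‖v t‖ ^ 2 := fun v =>
    integral_nonneg fun z => by positivity
  rw [F_eq_coe (nk _) (nn _ _) (hπ.kineticEnergy_eq hT hu) hV0,
    F_eq_coe (nk _) (nn _ _) (hπ.kineticEnergy_eq hT hw) hV1, EReal.coe_le_coe_iff] at hle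
  have hkin : ∫ t in Icc 0 G.T, 1 / 2 * ‖w t‖ ^ 2 = (∫ t in Icc 0 G.T, 1 / 2 * ‖u t‖ ^ 2) +
      ε * (∫ t in Icc 0 G.T, inner ℝ (u t) (ψ t)) + ε ^ 2 * ∫ t, 1 / 2 * ‖ψ t‖ ^ 2 ∂ν := by
    rw [← integral_const_mul, ← integral_const_mul, ← integral_add, ← integral_add]
    · refine integral_congr_ae (ae_of_all _ fun t => ?_)
      simp only [hwdef, Pi.add_apply]
      rw [norm_add_sq_real, inner_smul_right, norm_smul, mul_pow, Real.norm_eq_abs, sq_abs]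
      ring
    · exact (hu.integrable_sq.const_mul _).add (huψ.const_mul _)
    · exact (hψi.const_mul _).const_mul _
    · exact hu.integrable_sq.const_mul _
    · exact huψ.const_mul _
  have hfin : G.Ψ ((γ + Φ) ⟨G.T, right_mem_Icc.2 G.T_pos.le⟩) ≤
      G.Ψ (γ ⟨G.T, right_mem_Icc.2 G.T_pos.le⟩) + K * (ε * ‖φ G.T‖) := by
    have h1 := hK.dist_le_mul ((γ + Φ) ⟨G.T, right_mem_Icc.2 G.T_pos.le⟩)
      (γ ⟨G.T, right_mem_Icc.2 G.T_pos.le⟩)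
    rw [ContinuousMap.add_apply, dist_eq_norm (_ + _), add_sub_cancel_left, hΦe', Real.dist_eq] at h1
    have h2 := hπ.norm_le (ε • φ G.T)
    rw [norm_smul, Real.norm_eq_abs, abs_of_pos hε] at h2
    have h3 := (le_abs_self _).trans (h1.trans (mul_le_mul_of_nonneg_left h2 K.2))
    rw [ContinuousMap.add_apply, hΦe']
    linarith
  have hint : ∫ z : ℝ × Curve Ω G.T,
        1 / 2 * ‖w z.1 - G.vel hπ z.2 z.1‖ ^ 2 * G.weight (γ + Φ) z.2 z.1 ∂(ν.prod Q) ≤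
      (∫ z : ℝ × Curve Ω G.T,
        1 / 2 * ‖u z.1 - G.vel hπ z.2 z.1‖ ^ 2 * G.weight γ z.2 z.1 ∂(ν.prod Q)) +
      ε * V₁ + ε ^ 2 * B := by
    rw [hV₁, hB, ← integral_const_mul, ← integral_const_mul, ← integral_add, ← integral_add]
    · apply integral_mono_ae hV1i
      · exact (hV0i.add ((hI1.add hI2).const_mul _)).add (hI3.const_mul _)
      have hmem : ∀ᵐ t ∂ν, t ∈ Icc 0 G.T := ae_restrict_mem measurableSet_Icc
      filter_upwards [Measure.quasiMeasurePreserving_fst.ae hmem] with z hz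
      have hsplit : w z.1 - G.vel hπ z.2 z.1 = (u z.1 - G.vel hπ z.2 z.1) + ε • ψ z.1 := by
        simp only [hwdef, Pi.add_apply]
        abel
      rw [hsplit]
      have hcC : C * ‖φ z.1‖ ≤ C₁ := mul_le_mul_of_nonneg_left (hφR _ hz) hC0
      apply half_norm_sq_mul_le_expansion _ _ (weight_nonneg _ _ _) (hH _) hε.le hε1
        (by positivity) hcC ((mul_le_mul_of_nonneg_left hcC hε.le).trans hεC) _ (hR _)
      have hev : evalAt G.T_pos.le (γ + Φ) z.1 - evalAt G.T_pos.le z.2 z.1 =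
          (evalAt G.T_pos.le γ z.1 - evalAt G.T_pos.le z.2 z.1) + π (ε • φ z.1) := by
        simp only [evalAt, projIcc_of_mem hT.le hz, ContinuousMap.add_apply, hΦe']
        abel
      rw [weight, hev]
      refine (hC _ _).trans (le_of_eq ?_)
      rw [norm_smul, Real.norm_eq_abs, abs_of_pos hε, weight]
      congr 2
      ring
    · exact hV0i.add ((hI1.add hI2).const_mul _)
    · exact hI3.const_mul _
    · exact hV0i
    · exact (hI1.add hI2).const_mul _
  rw [hkin] at hle
  have h1 := mul_le_mul_of_nonneg_left hint G.lam_pos.le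
  change 0 ≤ ε * (G.δ * (∫ t, inner ℝ (u t) (ψ t) ∂ν) + K * ‖φ G.T‖ + G.lam * V₁) +
    ε ^ 2 * (G.δ * (∫ t, 1 / 2 * ‖ψ t‖ ^ 2 ∂ν) + G.lam * B)
  linarith

end MFG

end EulerLagrange

/-! ### Weak Euler-Lagrange inequality for the momentum -/

section Regularity

variable {d : ℕ} {Ω : Type} [NormedAddCommGroup Ω] [MeasurableSpace Ω] {π : Eucl d → Ω} {G : MFG Ω} {Q : Measure (Curve Ω G.T)}

namespace MFG

theorem energyDensity_nonneg (hπ : IsFlatCover π) (γ : Curve Ω G.T) (t : ℝ) :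
    0 ≤ G.energyDensity hπ Q γ t :=
  integral_nonneg fun _ => mul_nonneg (by positivity) (weight_nonneg _ _ _)

variable [BorelSpace Ω] [SecondCountableTopology Ω] [IsProbabilityMeasure Q]

theorem stronglyMeasurable_momentum (hπ : IsFlatCover π) :
    StronglyMeasurable fun q : Curve Ω G.T × ℝ => G.momentum hπ Q q.1 q.2 := by
  have h1 := stronglyMeasurable_vel (G := G) hπ
  have h2 : StronglyMeasurable fun q : (Curve Ω G.T × ℝ) × Curve Ω G.T =>
      G.weight q.1.1 q.2 q.1.2 • (G.vel hπ q.1.1 q.1.2 - G.vel hπ q.2 q.1.2) := by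
    refine measurable_weight.stronglyMeasurable.smul (StronglyMeasurable.sub ?_ ?_)
    · exact h1.comp_measurable measurable_fst
    · exact h1.comp_measurable
        (g := fun q : (Curve Ω G.T × ℝ) × Curve Ω G.T => (q.2, q.1.2)) (by fun_prop)
  exact (h1.const_smul G.δ).add ((h2.integral_prod_right' (ν := Q)).const_smul G.lam)

theorem integrable_weight_smul (hπ : IsFlatCover π) {M : ℝ≥0}
    (hM : ∀ᵐ ω ∂Q, IsH1 π ω ∧ kineticEnergy π ω ≤ M) {γ : Curve Ω G.T} (hγ : IsH1 π γ) :
    Integrable (fun z : ℝ × Curve Ω G.T =>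
      G.weight γ z.2 z.1 • (G.vel hπ γ z.1 - G.vel hπ z.2 z.1))
      ((volume.restrict (Icc 0 G.T)).prod Q) := by
  obtain ⟨H, hH⟩ := G.η_bounded
  have hi := (memLp_sub_vel hπ hM (hπ.hasL2Velocity_curveDeriv G.T_pos hγ)).integrable
    (by norm_num)
  refine hi.bdd_smul H (measurable_weight_prod γ).aestronglyMeasurable (ae_of_all _ fun z => ?_)
  rw [Real.norm_eq_abs, abs_of_nonneg (weight_nonneg _ _ _)]
  exact hH _

theorem integrableOn_momentum (hπ : IsFlatCover π) {M : ℝ≥0}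
    (hM : ∀ᵐ ω ∂Q, IsH1 π ω ∧ kineticEnergy π ω ≤ M) {γ : Curve Ω G.T} (hγ : IsH1 π γ) :
    IntegrableOn (G.momentum hπ Q γ) (Icc 0 G.T) := by
  have h1 : Integrable (G.vel hπ γ) (volume.restrict (Icc 0 G.T)) :=
    (hπ.hasL2Velocity_curveDeriv G.T_pos hγ).1.integrable (by norm_num)
  exact (h1.smul G.δ).add ((integrable_weight_smul hπ hM hγ).integral_prod_left.smul G.lam)

theorem integrableOn_energyDensity (hπ : IsFlatCover π) {M : ℝ≥0}
    (hM : ∀ᵐ ω ∂Q, IsH1 π ω ∧ kineticEnergy π ω ≤ M) {γ : Curve Ω G.T} (hγ : IsH1 π γ) :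
    IntegrableOn (G.energyDensity hπ Q γ) (Icc 0 G.T) :=
  (VQ_eq hπ hM (hπ.hasL2Velocity_curveDeriv G.T_pos hγ)).1.integral_prod_left

theorem integral_energyDensity_le (hπ : IsFlatCover π) {M : ℝ≥0}
    (hM : ∀ᵐ ω ∂Q, IsH1 π ω ∧ kineticEnergy π ω ≤ M) {γ : Curve Ω G.T} (hγ : IsH1 π γ)
    (hV : G.VQ π Q γ ≤ M) : ∫ t in Icc 0 G.T, G.energyDensity hπ Q γ t ≤ M := by
  obtain ⟨h1, h2⟩ := VQ_eq hπ hM (hπ.hasL2Velocity_curveDeriv G.T_pos hγ)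
  rw [h2, integral_prod _ h1] at hV
  exact (ENNReal.ofReal_le_iff_le_toReal ENNReal.coe_ne_top).1 hV

/-- Integrating the first variation in `ω` first, by Fubini, its linear terms become the pairing of
the momentum with `ψ`, and the terms from the change of `η` become the energy density against the
displacement. -/
theorem weakEulerLagrange (hπ : IsFlatCover π) {C : ℝ} (hC0 : 0 ≤ C)
    (hC : ∀ x z, G.η (x + π z) ≤ G.η x * Real.exp (C * ‖z‖)) {K : ℝ≥0}
    (hK : LipschitzWith K G.Ψ) {M : ℝ≥0}
    (hM : ∀ᵐ ω ∂Q, IsH1 π ω ∧ kineticEnergy π ω ≤ M) {γ : Curve Ω G.T} (hγ : IsH1 π γ)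
    (hmin : ∀ ω, G.start ω = G.start γ → G.F π Q γ ≤ G.F π Q ω) :
    WeakEulerLagrange G.T (G.momentum hπ Q γ) (G.energyDensity hπ Q γ) K (G.lam * C) := by
  rintro ψ hψ ⟨R, hR⟩
  have key := first_variation_nonneg hπ hC0 hC hK hM hγ hmin hψ hR
  set ν := volume.restrict (Icc 0 G.T) with hν
  set φ : ℝ → Eucl d := fun t => ∫ y in (0 : ℝ)..t, ψ y with hφ
  have hu := hπ.hasL2Velocity_curveDeriv G.T_pos hγ
  change HasL2Velocity π γ (G.vel hπ γ) at hu
  have hψm : AEStronglyMeasurable ψ ν := hψ.aestronglyMeasurable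
  have hi := integrable_weight_smul hπ hM hγ
  obtain ⟨he, -⟩ := VQ_eq hπ hM hu
  have hI1 : Integrable (fun z : ℝ × Curve Ω G.T =>
      inner ℝ (G.vel hπ γ z.1 - G.vel hπ z.2 z.1) (ψ z.1) * G.weight γ z.2 z.1) (ν.prod Q) := by
    have hψz : AEStronglyMeasurable (fun z : ℝ × Curve Ω G.T => ψ z.1) (ν.prod Q) := hψm.comp_fst
    have := hi.inner_of_bound hψz fun z => hR z.1
    refine this.congr (ae_of_all _ fun z => ?_)
    simp only
    rw [real_inner_smul_left, mul_comm]
  have hI2 : Integrable (fun z : ℝ × Curve Ω G.T =>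
      1 / 2 * ‖G.vel hπ γ z.1 - G.vel hπ z.2 z.1‖ ^ 2 * G.weight γ z.2 z.1 * (C * ‖φ z.1‖))
      (ν.prod Q) := by
    have hφc : Continuous φ := hψ.continuous_primitive_of_bound hR
    obtain ⟨R', hR'⟩ := (isCompact_Icc (a := (0 : ℝ)) (b := G.T)).exists_bound_of_continuousOn
      (f := fun t => C * ‖φ t‖) (by fun_prop)
    refine he.mul_bdd (c := R') ?_ ?_
    · exact (by fun_prop : Continuous fun t => C * ‖φ t‖).aestronglyMeasurable.comp_fst
    · have hmem : ∀ᵐ t ∂ν, t ∈ Icc 0 G.T := ae_restrict_mem measurableSet_Icc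
      filter_upwards [Measure.quasiMeasurePreserving_fst.ae hmem] with z hz
      exact hR' _ hz
  have e1 : ∫ z, inner ℝ (G.vel hπ γ z.1 - G.vel hπ z.2 z.1) (ψ z.1) * G.weight γ z.2 z.1
      ∂(ν.prod Q) = ∫ t, inner ℝ
        (∫ ω, G.weight γ ω t • (G.vel hπ γ t - G.vel hπ ω t) ∂Q) (ψ t) ∂ν := by
    rw [integral_prod _ hI1]
    apply integral_congr_ae
    filter_upwards [hi.prod_right_ae] with t ht
    rw [real_inner_comm, ← integral_inner ht]
    refine integral_congr_ae (ae_of_all _ fun ω => ?_)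
    simp only
    rw [real_inner_smul_right, real_inner_comm, mul_comm]
  have e2 : ∫ z, 1 / 2 * ‖G.vel hπ γ z.1 - G.vel hπ z.2 z.1‖ ^ 2 * G.weight γ z.2 z.1 *
      (C * ‖φ z.1‖) ∂(ν.prod Q) = C * ∫ t, G.energyDensity hπ Q γ t * ‖φ t‖ ∂ν := by
    rw [integral_prod _ hI2, ← integral_const_mul]
    refine integral_congr_ae (ae_of_all _ fun t => ?_)
    simp only
    rw [integral_mul_const, energyDensity]
    ring
  have e3 : ∫ t, inner ℝ (G.momentum hπ Q γ t) (ψ t) ∂ν =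
      G.δ * (∫ t, inner ℝ (G.vel hπ γ t) (ψ t) ∂ν) + G.lam * ∫ t, inner ℝ
        (∫ ω, G.weight γ ω t • (G.vel hπ γ t - G.vel hπ ω t) ∂Q) (ψ t) ∂ν := by
    rw [← integral_const_mul, ← integral_const_mul, ← integral_add]
    · refine integral_congr_ae (ae_of_all _ fun t => ?_)
      simp only
      rw [momentum, inner_add_left, real_inner_smul_left, real_inner_smul_left]
    · exact ((hu.1.integrable (by norm_num)).inner_of_bound hψm hR).const_mul _
    · exact (hi.integral_prod_left.inner_of_bound hψm hR).const_mul _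
  rw [integral_add hI1 hI2, e1, e2] at key
  rw [e3]
  linarith

end MFG

end Regularity

/-! ### Bounds on velocities and on their increments -/

section MaximumPrincipleForVelocities

variable {d : ℕ} {Ω : Type} [NormedAddCommGroup Ω] [MeasurableSpace Ω] [BorelSpace Ω]
  [SecondCountableTopology Ω] {π : Eucl d → Ω} {G : MFG Ω} {Q : Measure (Curve Ω G.T)}
  [IsProbabilityMeasure Q]

namespace MFG

/-- The exceptional times depend on the curve, so Fubini first turns the hypothesis into one on
almost every curve at almost every time. There the maximum principle bounds almost all velocities.
One more use of the averaged inequality then covers each curve of the support, including those in a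
`Q`-null set. -/
theorem ae_norm_vel_le (hπ : IsFlatCover π) {M : ℝ≥0}
    (hM : ∀ᵐ ω ∂Q, IsH1 π ω ∧ kineticEnergy π ω ≤ M) {P : ℝ}
    (hP : ∀ γ ∈ Q.support, ∀ᵐ t ∂volume.restrict (Icc 0 G.T), ‖G.momentum hπ Q γ t‖ ≤ P) :
    ∀ γ ∈ Q.support, ∀ᵐ t ∂volume.restrict (Icc 0 G.T), ‖G.vel hπ γ t‖ ≤ P / G.δ := by
  obtain ⟨H, hH⟩ := G.η_bounded
  have hint : ∀ᵐ t ∂volume.restrict (Icc 0 G.T), Integrable (fun ω => G.vel hπ ω t) Q :=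
    ((memLp_vel hπ hM).integrable (by norm_num)).prod_right_ae
  have hmeas : MeasurableSet {q : Curve Ω G.T × ℝ | ‖G.momentum hπ Q q.1 q.2‖ ≤ P} :=
    measurableSet_le (stronglyMeasurable_momentum hπ).norm.measurable measurable_const
  have hswap : ∀ᵐ t ∂volume.restrict (Icc 0 G.T), ∀ᵐ γ ∂Q, ‖G.momentum hπ Q γ t‖ ≤ P := by
    rw [← Measure.ae_ae_comm hmeas]
    filter_upwards [Measure.support_mem_ae] with γ hγ using hP γ hγ
  have hineq : ∀ (γ : Curve Ω G.T) (t : ℝ), Integrable (fun ω => G.vel hπ ω t) Q →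
      ‖G.momentum hπ Q γ t‖ ≤ P → (G.δ + G.lam * ∫ ω, G.weight γ ω t ∂Q) * ‖G.vel hπ γ t‖ ≤
        P + G.lam * ∫ ω, G.weight γ ω t * ‖G.vel hπ ω t‖ ∂Q := by
    intro γ t hi hp
    have := weighted_average_norm_le G.δ_pos G.lam_pos.le (measurable_weight_right γ t)
      (fun ω => weight_nonneg γ ω t) (fun ω => hH _) hi (G.vel hπ γ t)
    change _ ≤ ‖G.momentum hπ Q γ t‖ + _ at this
    linarith
  have hall : ∀ᵐ t ∂volume.restrict (Icc 0 G.T), ∀ᵐ γ ∂Q, ‖G.vel hπ γ t‖ ≤ P / G.δ := by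
    filter_upwards [hswap, hint] with t ht hi
    refine ae_le_of_ae_le_weighted_average (k := fun γ ω => G.weight γ ω t) (H := H) G.δ_pos
      G.lam_pos.le (fun γ => measurable_weight_right γ t) (fun γ ω => weight_nonneg γ ω t)
      (fun γ ω => hH _) hi.norm (fun _ => norm_nonneg _) ?_
    filter_upwards [ht] with γ hγ using hineq γ t hi hγ
  intro γ hγ
  filter_upwards [hP γ hγ, hint, hall] with t ht hi ha
  exact le_div_of_weighted_average G.δ_pos G.lam_pos.le (measurable_weight_right γ t)
    (fun ω => weight_nonneg γ ω t) (fun ω => hH _) hi.norm ha (hineq γ t hi ht)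

/-- The inequality satisfied by the increments of the velocities at two given times. -/
theorem weighted_norm_vel_sub_le (hπ : IsFlatCover π) {B P₁ : ℝ} {K : ℝ≥0} (hB : 0 ≤ B)
    (hK : LipschitzWith K G.η) {γ : Curve Ω G.T} {s t : ℝ}
    (hlipγ : dist (evalAt G.T_pos.le γ s) (evalAt G.T_pos.le γ t) ≤ B * |s - t|)
    (hlip : ∀ᵐ ω ∂Q, dist (evalAt G.T_pos.le ω s) (evalAt G.T_pos.le ω t) ≤ B * |s - t|)
    (hγs : ‖G.vel hπ γ s‖ ≤ B)
    (hs : ∀ᵐ ω ∂Q, ‖G.vel hπ ω s‖ ≤ B) (ht : ∀ᵐ ω ∂Q, ‖G.vel hπ ω t‖ ≤ B)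
    (hp : ‖G.momentum hπ Q γ s - G.momentum hπ Q γ t‖ ≤ P₁ * |s - t|) :
    (G.δ + G.lam * ∫ ω, G.weight γ ω t ∂Q) * ‖G.vel hπ γ s - G.vel hπ γ t‖ ≤
      (P₁ + G.lam * (4 * B ^ 2 * K)) * |s - t| +
        G.lam * ∫ ω, G.weight γ ω t * ‖G.vel hπ ω s - G.vel hπ ω t‖ ∂Q := by
  obtain ⟨H, hH⟩ := G.η_bounded
  have hkn : ∀ r ω, ‖G.weight γ ω r‖ ≤ H := fun r ω => by
    rw [Real.norm_eq_abs, abs_of_nonneg (weight_nonneg _ _ _)]; exact hH _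
  have is : Integrable (fun ω => G.vel hπ ω s) Q :=
    Integrable.of_bound (stronglyMeasurable_vel_left hπ s).aestronglyMeasurable B hs
  have it : Integrable (fun ω => G.vel hπ ω t) Q :=
    Integrable.of_bound (stronglyMeasurable_vel_left hπ t).aestronglyMeasurable B ht
  have iw : ∀ (r : ℝ) (f : Curve Ω G.T → Eucl d), Integrable f Q →
      Integrable (fun ω => G.weight γ ω r • f ω) Q := fun r f hf =>
    hf.bdd_smul H (measurable_weight_right γ r).aestronglyMeasurable (ae_of_all _ (hkn r))
  have ids : Integrable (fun ω => G.vel hπ γ s - G.vel hπ ω s) Q := (integrable_const _).sub is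
  have idt : Integrable (fun ω => G.vel hπ γ t - G.vel hπ ω t) Q := (integrable_const _).sub it
  have key := weighted_average_norm_le G.δ_pos G.lam_pos.le (measurable_weight_right γ t)
      (fun ω => weight_nonneg γ ω t) (fun ω => hH _) (is.sub it) (G.vel hπ γ s - G.vel hπ γ t)
  simp only [Pi.sub_apply] at key
  -- The error of replacing the weight at `s` by the weight at `t`. The weight varies by at most `K
  -- · 2B|s - t|` and the relative velocity is at most `2B`, whence `4B²K`.
  set r := ∫ ω, (G.weight γ ω s - G.weight γ ω t) • (G.vel hπ γ s - G.vel hπ ω s) ∂Q with hr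
  have hid : G.δ • (G.vel hπ γ s - G.vel hπ γ t) + G.lam • ∫ ω, G.weight γ ω t •
      ((G.vel hπ γ s - G.vel hπ γ t) - (G.vel hπ ω s - G.vel hπ ω t)) ∂Q =
      (G.momentum hπ Q γ s - G.momentum hπ Q γ t) - G.lam • r := by
    have h1 : ∫ ω, G.weight γ ω t •
        ((G.vel hπ γ s - G.vel hπ γ t) - (G.vel hπ ω s - G.vel hπ ω t)) ∂Q =
        (∫ ω, G.weight γ ω s • (G.vel hπ γ s - G.vel hπ ω s) ∂Q) -
        (∫ ω, G.weight γ ω t • (G.vel hπ γ t - G.vel hπ ω t) ∂Q) - r := by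
      rw [hr, ← integral_sub (iw s _ ids) (iw t _ idt), ← integral_sub]
      · refine integral_congr_ae (ae_of_all _ fun ω => ?_)
        simp only
        module
      · exact (iw s _ ids).sub (iw t _ idt)
      · simp_rw [sub_smul]
        exact (iw s _ ids).sub (iw t _ ids)
    rw [h1, momentum, momentum]
    module
  have hrb : ‖r‖ ≤ (4 * B ^ 2 * K) * |s - t| := by
    have : ∀ᵐ ω ∂Q, ‖(G.weight γ ω s - G.weight γ ω t) • (G.vel hπ γ s - G.vel hπ ω s)‖ ≤
        (4 * B ^ 2 * K) * |s - t| := by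
      filter_upwards [hlip, hs] with ω hω hωs
      rw [norm_smul]
      have h1 : ‖G.weight γ ω s - G.weight γ ω t‖ ≤ K * (2 * B * |s - t|) := by
        rw [← dist_eq_norm]
        refine (hK.dist_le_mul _ _).trans ?_
        gcongr
        refine (dist_sub_sub_le _ _ _ _).trans ?_
        linarith
      have h2 : ‖G.vel hπ γ s - G.vel hπ ω s‖ ≤ 2 * B := (norm_sub_le _ _).trans (by linarith)
      calc _ ≤ (K * (2 * B * |s - t|)) * (2 * B) := by gcongr
        _ = _ := by ring
    simpa using norm_integral_le_of_norm_le_const this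
  rw [hid] at key
  have h3 : ‖(G.momentum hπ Q γ s - G.momentum hπ Q γ t) - G.lam • r‖ ≤
      (P₁ + G.lam * (4 * B ^ 2 * K)) * |s - t| := by
    refine (norm_sub_le _ _).trans ?_
    rw [norm_smul, Real.norm_eq_abs, abs_of_pos G.lam_pos]
    have := mul_le_mul_of_nonneg_left hrb G.lam_pos.le
    linarith
  linarith

/-- The maximum principle again, now at almost every pair of times, with the norms of the velocity
increments as unknowns and weights frozen at the second time. -/
theorem ae_norm_vel_sub_le (hπ : IsFlatCover π) {M : ℝ≥0}
    (hM : ∀ γ ∈ Q.support, IsH1 π γ ∧ kineticEnergy π γ ≤ M) {B P₁ : ℝ} {K : ℝ≥0} (hB : 0 ≤ B)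
    (hK : LipschitzWith K G.η)
    (hv : ∀ γ ∈ Q.support, ∀ᵐ t ∂volume.restrict (Icc 0 G.T), ‖G.vel hπ γ t‖ ≤ B)
    (hp : ∀ γ ∈ Q.support,
      ∀ᵐ z ∂(volume.restrict (Icc 0 G.T)).prod (volume.restrict (Icc 0 G.T)),
        ‖G.momentum hπ Q γ z.1 - G.momentum hπ Q γ z.2‖ ≤ P₁ * |z.1 - z.2|) :
    ∀ γ ∈ Q.support,
      ∀ᵐ z ∂(volume.restrict (Icc 0 G.T)).prod (volume.restrict (Icc 0 G.T)),
        ‖G.vel hπ γ z.1 - G.vel hπ γ z.2‖ ≤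
          (P₁ + G.lam * (4 * B ^ 2 * K)) / G.δ * |z.1 - z.2| := by
  obtain ⟨H, hH⟩ := G.η_bounded
  set ν := volume.restrict (Icc 0 G.T) with hν
  have hsupp : ∀ᵐ γ ∂Q, γ ∈ Q.support := Measure.support_mem_ae
  have hmem : ∀ᵐ t ∂ν, t ∈ Icc 0 G.T := ae_restrict_mem measurableSet_Icc
  have hlip : ∀ γ ∈ Q.support, ∀ s ∈ Icc 0 G.T, ∀ t ∈ Icc 0 G.T,
      dist (evalAt G.T_pos.le γ s) (evalAt G.T_pos.le γ t) ≤ B * |s - t| := fun γ hγ s hs t ht =>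
    hπ.dist_evalAt_le G.T_pos (hπ.hasL2Velocity_curveDeriv G.T_pos (hM γ hγ).1) (hv γ hγ) hs ht
  have hvswap : ∀ᵐ t ∂ν, ∀ᵐ γ ∂Q, ‖G.vel hπ γ t‖ ≤ B := by
    have hmeas : MeasurableSet {q : Curve Ω G.T × ℝ | ‖G.vel hπ q.1 q.2‖ ≤ B} :=
      measurableSet_le (stronglyMeasurable_vel hπ).norm.measurable measurable_const
    rw [← Measure.ae_ae_comm hmeas]
    filter_upwards [hsupp] with γ hγ using hv γ hγ
  have hpswap : ∀ᵐ z ∂ν.prod ν, ∀ᵐ γ ∂Q,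
      ‖G.momentum hπ Q γ z.1 - G.momentum hπ Q γ z.2‖ ≤ P₁ * |z.1 - z.2| := by
    have hm := stronglyMeasurable_momentum (G := G) (Q := Q) hπ
    have hm1 : StronglyMeasurable fun q : Curve Ω G.T × (ℝ × ℝ) => G.momentum hπ Q q.1 q.2.1 :=
      hm.comp_measurable (g := fun q : Curve Ω G.T × (ℝ × ℝ) => (q.1, q.2.1)) (by fun_prop)
    have hm2 : StronglyMeasurable fun q : Curve Ω G.T × (ℝ × ℝ) => G.momentum hπ Q q.1 q.2.2 :=
      hm.comp_measurable (g := fun q : Curve Ω G.T × (ℝ × ℝ) => (q.1, q.2.2)) (by fun_prop)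
    have hmeas : MeasurableSet {q : Curve Ω G.T × (ℝ × ℝ) |
        ‖G.momentum hπ Q q.1 q.2.1 - G.momentum hπ Q q.1 q.2.2‖ ≤ P₁ * |q.2.1 - q.2.2|} :=
      measurableSet_le (hm1.sub hm2).norm.measurable (by fun_prop)
    rw [← Measure.ae_ae_comm hmeas]
    filter_upwards [hsupp] with γ hγ using hp γ hγ
  have q1 : Measure.QuasiMeasurePreserving Prod.fst (ν.prod ν) ν :=
    Measure.quasiMeasurePreserving_fst
  have q2 : Measure.QuasiMeasurePreserving Prod.snd (ν.prod ν) ν :=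
    Measure.quasiMeasurePreserving_snd
  have hall : ∀ᵐ z ∂ν.prod ν, ∀ᵐ γ ∂Q, ‖G.vel hπ γ z.1 - G.vel hπ γ z.2‖ ≤
      (P₁ + G.lam * (4 * B ^ 2 * K)) * |z.1 - z.2| / G.δ := by
    filter_upwards [hpswap, q1.ae hvswap, q2.ae hvswap, q1.ae hmem, q2.ae hmem]
      with z hz hz1 hz2 hm1 hm2
    have int : ∀ t, (∀ᵐ γ ∂Q, ‖G.vel hπ γ t‖ ≤ B) → Integrable (fun ω => G.vel hπ ω t) Q :=
      fun t => Integrable.of_bound (stronglyMeasurable_vel_left hπ t).aestronglyMeasurable B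
    refine ae_le_of_ae_le_weighted_average (k := fun γ ω => G.weight γ ω z.2) (H := H) G.δ_pos
      G.lam_pos.le (fun γ => measurable_weight_right γ z.2) (fun γ ω => weight_nonneg γ ω z.2)
      (fun γ ω => hH _) ((int _ hz1).sub (int _ hz2)).norm (fun _ => norm_nonneg _) ?_
    filter_upwards [hz, hz1, hsupp] with γ hγ hγ1 hγs
    exact weighted_norm_vel_sub_le hπ hB hK (hlip γ hγs _ hm1 _ hm2)
      (by filter_upwards [hsupp] with ω hω using hlip ω hω _ hm1 _ hm2) hγ1 hz1 hz2 hγ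
  intro γ hγ
  filter_upwards [hp γ hγ, q1.ae (hv γ hγ), q1.ae hvswap, q2.ae hvswap, q1.ae hmem, q2.ae hmem,
    hall] with z hz hγ1 hz1 hz2 hm1 hm2 ha
  have int : ∀ t, (∀ᵐ γ ∂Q, ‖G.vel hπ γ t‖ ≤ B) → Integrable (fun ω => G.vel hπ ω t) Q :=
    fun t => Integrable.of_bound (stronglyMeasurable_vel_left hπ t).aestronglyMeasurable B
  rw [div_mul_eq_mul_div]
  exact le_div_of_weighted_average G.δ_pos G.lam_pos.le (measurable_weight_right γ z.2)
    (fun ω => weight_nonneg γ ω z.2) (fun ω => hH _) ((int _ hz1).sub (int _ hz2)).norm ha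
    (weighted_norm_vel_sub_le hπ hB hK (hlip γ hγ _ hm1 _ hm2)
      (by filter_upwards [hsupp] with ω hω using hlip ω hω _ hm1 _ hm2) hγ1 hz1 hz2 hz)

end MFG

end MaximumPrincipleForVelocities

/-! ### Regularity of equilibria on a flat cover -/

section Equilibria

variable {d : ℕ} {Ω : Type} [NormedAddCommGroup Ω] [MeasurableSpace Ω] {π : Eucl d → Ω}
  {G : MFG Ω}

namespace MFG

/-- The condition `|∇η| ≤ C η` says that `log η` is `C`-Lipschitz. -/
theorem KernelCondition.exists_le_mul_exp (hπ : IsFlatCover π) (h : G.KernelCondition π) :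
    ∃ C : ℝ, 0 ≤ C ∧ ∀ x z, G.η (x + π z) ≤ G.η x * Real.exp (C * ‖z‖) := by
  obtain ⟨hpos, ⟨K, hK⟩, C, hC⟩ := h
  refine ⟨|C|, abs_nonneg C, fun x z => ?_⟩
  obtain ⟨y, rfl⟩ := hπ.surjective x
  rw [← hπ.map_add]
  refine (hK.comp hπ.lipschitz).le_mul_exp_of_norm_fderiv_le (fun w hw => ?_) y z
  exact (hC w hw).trans (mul_le_mul_of_nonneg_right (le_abs_self C) (hpos _).le)

theorem IsEquilibrium.exists_isC11With [BorelSpace Ω] [SecondCountableTopology Ω]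
    {Q : Measure (Curve Ω G.T)} (hπ : IsFlatCover π) (hη : G.KernelCondition π)
    (hΨ : G.FinalCostCondition) (hQ : G.IsEquilibrium π Q)
    (h : (∫⁻ x, ENNReal.ofReal (-G.Ψ x) ∂G.m₀ < ⊤) ∨ (∫⁻ γ, kineticEnergy π γ ∂Q < ⊤)) :
    ∃ L : ℝ≥0, ∀ γ ∈ Q.support, IsC11With π L γ := by
  have := hQ.isProb
  obtain ⟨M, hM⟩ := hQ.exists_energy_bound hπ hΨ
    (h.elim (hQ.lintegral_kineticEnergy_lt_top hπ hΨ) id)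
  obtain ⟨C, hC0, hC⟩ := hη.exists_le_mul_exp hπ
  obtain ⟨-, ⟨Kη, hKη⟩, -⟩ := hη
  obtain ⟨K, hK⟩ := hΨ
  obtain ⟨H, hH⟩ := G.η_bounded
  have hδ := G.δ_pos
  have hlam := G.lam_pos
  have hH0 : 0 ≤ H := (G.η_nonneg 0).trans (hH 0)
  have hsupp : ∀ᵐ γ ∂Q, γ ∈ Q.support := Measure.support_mem_ae
  have hMae : ∀ᵐ ω ∂Q, IsH1 π ω ∧ kineticEnergy π ω ≤ M := by
    filter_upwards [hsupp] with ω hω using ⟨(hM ω hω).1, (hM ω hω).2.1⟩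
  have hEL : ∀ γ ∈ Q.support, WeakEulerLagrange G.T (G.momentum hπ Q γ)
      (G.energyDensity hπ Q γ) K (G.lam * C) := fun γ hγ =>
    weakEulerLagrange hπ hC0 hC hK hMae (hM γ hγ).1 fun ω hω => hQ.le hγ hω
  have hP : ∀ γ ∈ Q.support, ∀ᵐ t ∂volume.restrict (Icc 0 G.T),
      ‖G.momentum hπ Q γ t‖ ≤ K + G.lam * C * M := by
    intro γ hγ
    have h1 := integral_energyDensity_le hπ hMae (hM γ hγ).1 (hM γ hγ).2.2
    filter_upwards [(hEL γ hγ).ae_norm_le G.T_pos (integrableOn_momentum hπ hMae (hM γ hγ).1)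
      (integrableOn_energyDensity hπ hMae (hM γ hγ).1) (energyDensity_nonneg hπ γ) K.2
      (by positivity)] with t ht
    refine ht.trans ?_
    gcongr
  have hv := ae_norm_vel_le hπ hMae hP
  set B := (K + G.lam * C * M) / G.δ with hB
  have hB0 : 0 ≤ B := by positivity
  have hvswap : ∀ᵐ t ∂volume.restrict (Icc 0 G.T), ∀ᵐ γ ∂Q, ‖G.vel hπ γ t‖ ≤ B := by
    have hmeas : MeasurableSet {q : Curve Ω G.T × ℝ | ‖G.vel hπ q.1 q.2‖ ≤ B} :=
      measurableSet_le (stronglyMeasurable_vel hπ).norm.measurable measurable_const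
    rw [← Measure.ae_ae_comm hmeas]
    filter_upwards [hsupp] with γ hγ using hv γ hγ
  -- The velocity bound upgrades `e` from integrable to bounded, by `½(2B)²H`; this is what makes
  -- the momentum Lipschitz.
  have he : ∀ γ ∈ Q.support, ∀ᵐ t ∂volume.restrict (Icc 0 G.T),
      G.energyDensity hπ Q γ t ≤ 2 * B ^ 2 * H := by
    intro γ hγ
    filter_upwards [hv γ hγ, hvswap] with t ht hts
    have h1 : ∀ᵐ ω ∂Q, ‖1 / 2 * ‖G.vel hπ γ t - G.vel hπ ω t‖ ^ 2 * G.weight γ ω t‖ ≤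
        2 * B ^ 2 * H := by
      filter_upwards [hts] with ω hω
      have h2 : ‖G.vel hπ γ t - G.vel hπ ω t‖ ≤ 2 * B := (norm_sub_le _ _).trans (by linarith)
      have h3 := weight_nonneg γ ω t
      rw [Real.norm_eq_abs, abs_of_nonneg (by positivity)]
      calc _ ≤ 1 / 2 * (2 * B) ^ 2 * H := by
            gcongr
            exact hH _
        _ = _ := by ring
    have h4 := norm_integral_le_of_norm_le_const h1
    rw [probReal_univ, mul_one] at h4
    exact (le_abs_self _).trans h4
  have hp := fun γ hγ => (hEL γ hγ).ae_norm_sub_le G.T_pos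
    (integrableOn_momentum hπ hMae (hM γ hγ).1) (energyDensity_nonneg hπ γ) (he γ hγ)
    (by positivity)
  have hlip := ae_norm_vel_sub_le hπ (fun γ hγ => ⟨(hM γ hγ).1, (hM γ hγ).2.1⟩) hB0 hKη hv hp
  set L := (G.lam * C * (2 * B ^ 2 * H) + G.lam * (4 * B ^ 2 * Kη)) / G.δ with hL
  have hL0 : 0 ≤ L := by positivity
  -- The extra factor is the cost of extending a vector-valued Lipschitz map from a set of full
  -- measure to the line; it depends on `d` only.
  refine ⟨lipschitzExtensionConstant (Eucl d) * L.toNNReal, fun γ hγ => ?_⟩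
  obtain ⟨g, hg, hge⟩ := exists_lipschitzWith_ae_eq (L := L.toNNReal) (by
    rw [Real.coe_toNNReal L hL0]
    exact hlip γ hγ)
  exact (hπ.hasL2Velocity_curveDeriv G.T_pos (hM γ hγ).1).isC11With hge hg

end MFG

theorem isFlatCover_id (d : ℕ) : IsFlatCover (id : Eucl d → Eucl d) where
  map_add _ _ := rfl
  lipschitz := LipschitzWith.id
  exists_section := ⟨id, measurable_id, fun _ => rfl, 1, one_pos, fun _ _ => rfl⟩

theorem isFlatCover_torusProj (d : ℕ) : IsFlatCover (torusProj d) where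
  map_add x y := by
    ext i
    simp [torusProj]
  lipschitz := by
    refine LipschitzWith.of_dist_le_mul fun x y => ?_
    rw [NNReal.coe_one, one_mul, dist_pi_le_iff dist_nonneg]
    intro i
    calc dist (torusProj d x i) (torusProj d y i) = ‖((x i - y i : ℝ) : UnitAddCircle)‖ := by
          rw [dist_eq_norm, AddCircle.coe_sub]; rfl
      _ ≤ |x i - y i| := by
          rw [← Real.norm_eq_abs]
          exact QuotientAddGroup.norm_mk_le_norm
      _ ≤ dist x y := by
          rw [dist_eq_norm, ← Real.norm_eq_abs]
          exact PiLp.norm_apply_le (x - y) i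
  exists_section := by
    -- Representatives are taken in `(-1/2, 1/2]`, centred at `0`, so that a vector of norm less
    -- than `1/2` is its own representative.
    refine ⟨fun x => WithLp.toLp 2 fun i => (AddCircle.measurableEquivIoc 1 (-1 / 2) (x i) : ℝ),
      ?_, fun x => ?_, 1 / 2, by norm_num, fun y hy => ?_⟩
    · have : Measurable fun x : UnitAddTorus (Fin d) =>
          fun i => (AddCircle.measurableEquivIoc 1 (-1 / 2) (x i) : ℝ) := by
        refine measurable_pi_lambda _ fun i => ?_
        exact measurable_subtype_coe.comp
          ((AddCircle.measurableEquivIoc 1 (-1 / 2)).measurable.comp (measurable_pi_apply i))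
      exact (WithLp.measurable_toLp 2 _).comp this
    · ext i
      exact (AddCircle.equivIoc 1 (-1 / 2)).symm_apply_apply (x i)
    · ext i
      have h1 : |y i| < 1 / 2 := by
        rw [← Real.norm_eq_abs]
        exact (PiLp.norm_apply_le y i).trans_lt hy
      have h2 : y i ∈ Ioc (-1 / 2 : ℝ) (-1 / 2 + 1) := by
        rw [abs_lt] at h1
        constructor <;> linarith
      have h3 := (AddCircle.equivIoc (1 : ℝ) (-1 / 2)).apply_symm_apply ⟨y i, h2⟩
      exact congrArg Subtype.val h3

end Equilibria

/-! ### The two cases of the theorem -/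

theorem lemmaC11 (d : ℕ) :
    -- the whole space
    (∀ G : MFG (Eucl d), G.KernelCondition (id : Eucl d → Eucl d) → G.FinalCostCondition →
      ∀ Q : Measure (Curve (Eucl d) G.T), G.IsEquilibrium id Q →
        ((∫⁻ x, ENNReal.ofReal (-G.Ψ x) ∂G.m₀ < ⊤) ∨
          (∫⁻ γ, kineticEnergy (id : Eucl d → Eucl d) γ ∂Q < ⊤)) →
        ∃ L : ℝ≥0, ∀ γ ∈ Q.support, IsC11With (id : Eucl d → Eucl d) L γ) ∧
    -- the torus
    (∀ G : MFG (UnitAddTorus (Fin d)), G.KernelCondition (torusProj d) → G.FinalCostCondition →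
      ∀ Q : Measure (Curve (UnitAddTorus (Fin d)) G.T), G.IsEquilibrium (torusProj d) Q →
        ∃ L : ℝ≥0, ∀ γ ∈ Q.support, IsC11With (torusProj d) L γ) := by
  refine ⟨fun G hη hΨ Q hQ h => hQ.exists_isC11With (isFlatCover_id d) hη hΨ h,
    fun G hη hΨ Q hQ => hQ.exists_isC11With (isFlatCover_torusProj d) hη hΨ (Or.inl ?_)⟩
  have := G.m₀_prob
  -- On the compact torus `Ψ` is bounded, so its negative part is integrable without further
  -- assumption.
  obtain ⟨R, hR⟩ := isCompact_univ.exists_bound_of_continuousOn G.Ψ_continuous.continuousOn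
  calc ∫⁻ x, ENNReal.ofReal (-G.Ψ x) ∂G.m₀ ≤ ∫⁻ _, ENNReal.ofReal R ∂G.m₀ := by
        refine lintegral_mono fun x => ENNReal.ofReal_le_ofReal ?_
        exact (neg_le_abs _).trans (hR x (mem_univ x))
    _ < ⊤ := by simp
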